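/- Let $k$ be a field and let $G$ be a group. Let $J_k$ be the augmentation ideal of the group algebra $kG$ (the kernel of $\varepsilon: kG\to k$, $g\mapsto 1$), and let $kG^\wedge=\varprojlim_l kG/J_k^l$ be the completed group algebra, with comultiplication $\Delta: kG^\wedge\to kG^\wedge\hat\otimes\, kG^\wedge=\varprojlim_l\,(kG/J_k^l\otimes_k kG/J_k^l)$ induced by $g\mapsto g\otimes g$ and augmentation induced by $\varepsilon$. Let $$\mathcal P=\{x\in kG^\wedge : \Delta(x)=x\otimes x,\ \varepsilon(x)=1\}$$ be the group of grouplike elements, a subgroup of the group of units of $kG^\wedge$. It is the group of $k$-points of the group functor over $k$, also denoted $\mathcal P$, whose points in a commutative $k$-algebra $R$ are the grouplike elements of $RG^\wedge=\varprojlim_l RG/J_R^l$, where $J_R$ is the augmentation ideal of $RG$ and $\Delta$, $\varepsilon$ are formed over $R$. A unipotent group over $k$ is a closed $k$-subgroup $U\subset GL(V)$, for a finite dimensional $k$-vector space $V$, for which there is a filtration $V=V^0\supset V^1\supset\cdots\supset V^m=0$ by subspaces such that $U$ acts trivially on each quotient $V^i/V^{i+1}$. A prounipotent group over $k$ is an inverse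 limit of an inverse system of unipotent groups over $k$. (Algebraic groups over $k$ and their inverse limits are understood as group schemes, that is, through their functors of points on commutative $k$-algebras.) If $H_1(G,k)$ is finite dimensional over $k$, then the canonical map $G\to\mathcal P$, $g\mapsto g$, is the unipotent $k$-completion of $G$. That is: $\mathcal P$ is a prounipotent group over $k$, and for every prounipotent group $\mathcal E$ over $k$ and every group homomorphism $\phi: G\to\mathcal E(k)$ there is a unique homomorphism $\Phi:\mathcal P\to\mathcal E$ of proalgebraic groups over $k$ such that the composite $G\to\mathcal P(k)\xrightarrow{\Phi}\mathcal E(k)$ is $\phi$. -/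

import Mathlib

open CategoryTheory TensorProduct

universe u

namespace UnipotentCompletion

noncomputable section

/-! ### The completed group algebra and its grouplike elements -/

section GroupAlgebra

variable (R G : Type*) [CommRing R] [Group G]

/-- The augmentation ideal `J` of `R[G]`: the kernel of the augmentation (which is the counit of the
Hopf algebra `R[G]`, `g ↦ 1`). -/
def augIdeal : Ideal (MonoidAlgebra R G) :=
  RingHom.ker (Bialgebra.counitAlgHom R (MonoidAlgebra R G))

instance : (augIdeal R G).IsTwoSided := inferInstanceAs (RingHom.ker _).IsTwoSided

/-- The truncation `R[G] / J ^ l`. -/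
def Trunc (l : ℕ) := MonoidAlgebra R G ⧸ (augIdeal R G) ^ l

instance (l : ℕ) : Ring (Trunc R G l) :=
  inferInstanceAs (Ring (MonoidAlgebra R G ⧸ (augIdeal R G) ^ l))

instance (l : ℕ) : Algebra R (Trunc R G l) :=
  inferInstanceAs (Algebra R (MonoidAlgebra R G ⧸ (augIdeal R G) ^ l))

variable {R G}

/-- The projection `R[G] → R[G] / J ^ l`. -/
def Trunc.mk (l : ℕ) : MonoidAlgebra R G →ₐ[R] Trunc R G l :=
  Ideal.Quotient.mkₐ R ((augIdeal R G) ^ l)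

theorem Trunc.mk_surjective (l : ℕ) : Function.Surjective (Trunc.mk (R := R) (G := G) l) :=
  Ideal.Quotient.mkₐ_surjective R _

theorem Trunc.mk_eq_zero_iff {l : ℕ} {a : MonoidAlgebra R G} :
    Trunc.mk l a = 0 ↔ a ∈ augIdeal R G ^ l :=
  Ideal.Quotient.eq_zero_iff_mem

/-- The projection `R[G] / J ^ n → R[G] / J ^ m` for `m ≤ n`. -/
def Trunc.factor {m n : ℕ} (h : m ≤ n) : Trunc R G n →ₐ[R] Trunc R G m :=
  Ideal.Quotient.factorₐ R (Ideal.pow_le_pow_right (I := augIdeal R G) h)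

theorem Trunc.factor_mk {m n : ℕ} (h : m ≤ n) (a : MonoidAlgebra R G) :
    Trunc.factor h (Trunc.mk n a) = Trunc.mk m a := rfl

variable (R G) in
/-- The completed group algebra `R[G]^ = lim R[G] / J ^ l`: compatible sequences in
`∏ l, R[G] / J ^ l`. -/
def Completion : Subalgebra R (∀ l, Trunc R G l) where
  carrier := {x | ∀ (m n : ℕ) (h : m ≤ n), Trunc.factor h (x n) = x m}
  mul_mem' hx hy m n h := by simp only [Pi.mul_apply, map_mul, hx m n h, hy m n h]
  add_mem' hx hy m n h := by simp only [Pi.add_apply, map_add, hx m n h, hy m n h]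
  algebraMap_mem' r m n h := by simp only [Pi.algebraMap_apply, AlgHom.commutes]

/-- The projection `R[G]^ → R[G] / J ^ l`. -/
def Completion.proj (l : ℕ) : Completion R G →ₐ[R] Trunc R G l :=
  (Pi.evalAlgHom R (Trunc R G) l).comp (Completion R G).val

theorem Completion.factor_proj {m n : ℕ} (h : m ≤ n) (x : Completion R G) :
    Trunc.factor h (proj n x) = proj m x := x.2 m n h

theorem Completion.ext {x y : Completion R G} (h : ∀ l, proj l x = proj l y) : x = y :=
  Subtype.ext (funext h)

/-- The composite `R[G] → R[G] ⊗ R[G] → R[G] / J ^ l ⊗ R[G] / J ^ l` of the comultiplication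
`g ↦ g ⊗ g` and the projection. -/
def comulMod (l : ℕ) : MonoidAlgebra R G →ₐ[R] Trunc R G l ⊗[R] Trunc R G l :=
  (Algebra.TensorProduct.map (Trunc.mk l) (Trunc.mk l)).comp
    (Bialgebra.comulAlgHom R (MonoidAlgebra R G))

theorem comulMod_of (l : ℕ) (g : G) :
    comulMod l (MonoidAlgebra.of R G g) =
      Trunc.mk l (MonoidAlgebra.of R G g) ⊗ₜ[R] Trunc.mk l (MonoidAlgebra.of R G g) := by
  simp [comulMod]

variable (R G) in
/-- The span of the `b ⊗ c` with `b ∈ J ^ i`, `c ∈ J ^ j` and `i + j = n`. -/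
def tensorFiltration (l n : ℕ) : Submodule R (Trunc R G l ⊗[R] Trunc R G l) :=
  Submodule.span R {t | ∃ i j, i + j = n ∧ ∃ b ∈ augIdeal R G ^ i, ∃ c ∈ augIdeal R G ^ j,
    Trunc.mk l b ⊗ₜ[R] Trunc.mk l c = t}

theorem tmul_mem_tensorFiltration {l : ℕ} (i j : ℕ) {b c : MonoidAlgebra R G}
    (hb : b ∈ augIdeal R G ^ i) (hc : c ∈ augIdeal R G ^ j) :
    Trunc.mk l b ⊗ₜ[R] Trunc.mk l c ∈ tensorFiltration R G l (i + j) :=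
  Submodule.subset_span ⟨i, j, rfl, b, hb, c, hc, rfl⟩

theorem comulMod_sub_counit_mem (l : ℕ) (a : MonoidAlgebra R G) :
    comulMod l a - algebraMap R _ (Bialgebra.counitAlgHom R (MonoidAlgebra R G) a) ∈
      tensorFiltration R G l 1 := by
  induction a using MonoidAlgebra.induction_on with
  | of g =>
    have hg : MonoidAlgebra.of R G g - 1 ∈ augIdeal R G ^ 1 := by
      rw [Submodule.pow_one]
      simp [augIdeal, RingHom.mem_ker]
    have h0 : ∀ a : MonoidAlgebra R G, a ∈ augIdeal R G ^ 0 := fun a => by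
      simp [Submodule.pow_zero]
    have h1 : Bialgebra.counitAlgHom R (MonoidAlgebra R G) (MonoidAlgebra.of R G g) = 1 := by
      simp
    have key := add_mem (tmul_mem_tensorFiltration (l := l) 1 0 hg (h0 (MonoidAlgebra.of R G g)))
      (tmul_mem_tensorFiltration (l := l) 0 1 (h0 1) hg)
    rw [comulMod_of, h1, map_one, Algebra.TensorProduct.one_def]
    rw [map_sub, map_one, TensorProduct.sub_tmul, TensorProduct.tmul_sub,
      sub_add_sub_cancel] at key
    exact key
  | add a b ha hb =>
    rw [map_add, map_add, map_add, add_sub_add_comm]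
    exact add_mem ha hb
  | smul r a ha =>
    rw [map_smul, map_smul, smul_eq_mul, map_mul, ← Algebra.smul_def, ← smul_sub]
    exact Submodule.smul_mem _ _ ha

theorem comulMod_mem (l n : ℕ) (a : MonoidAlgebra R G) (ha : a ∈ augIdeal R G ^ n) :
    comulMod l a ∈ tensorFiltration R G l n := by
  induction n generalizing a with
  | zero =>
    induction comulMod l a using TensorProduct.induction_on with
    | zero => exact zero_mem _
    | add x y hx hy => exact add_mem hx hy
    | tmul x y =>
      obtain ⟨x, rfl⟩ := Trunc.mk_surjective l x
      obtain ⟨y, rfl⟩ := Trunc.mk_surjective l y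
      exact tmul_mem_tensorFiltration 0 0 (by simp [Submodule.pow_zero])
        (by simp [Submodule.pow_zero])
  | succ n ih =>
    rw [Submodule.pow_succ] at ha
    induction ha using Submodule.mul_induction_on' with
    | add x _ y _ hx hy => rw [map_add]; exact add_mem hx hy
    | mem_mul_mem x hx y hy =>
      rw [map_mul]
      have h1 := comulMod_sub_counit_mem l y
      have hy0 : Bialgebra.counitAlgHom R (MonoidAlgebra R G) y = 0 := hy
      rw [hy0, map_zero, sub_zero] at h1
      have := Submodule.mul_mem_mul (ih x hx) h1
      rw [tensorFiltration, tensorFiltration, Submodule.span_mul_span] at this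
      refine Submodule.span_mono ?_ this
      rintro _ ⟨_, ⟨i, j, hij, b, hb, c, hc, rfl⟩, _, ⟨i', j', hij', b', hb', c', hc', rfl⟩, rfl⟩
      refine ⟨i + i', j + j', by omega, b * b', ?_, c * c', ?_, ?_⟩
      · rw [Ideal.IsTwoSided.pow_add]; exact Ideal.mul_mem_mul hb hb'
      · rw [Ideal.IsTwoSided.pow_add]; exact Ideal.mul_mem_mul hc hc'
      · simp [Algebra.TensorProduct.tmul_mul_tmul]

theorem comulMod_eq_zero (l : ℕ) (a : MonoidAlgebra R G) (ha : a ∈ augIdeal R G ^ (2 * l)) :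
    comulMod l a = 0 := by
  suffices hs : tensorFiltration R G l (2 * l) ≤ ⊥ by simpa using hs (comulMod_mem l _ a ha)
  rw [tensorFiltration, Submodule.span_le]
  rintro _ ⟨i, j, hij, b, hb, c, hc, rfl⟩
  rcases (by omega : l ≤ i ∨ l ≤ j) with hl | hl
  · simp [Trunc.mk_eq_zero_iff.2 (Ideal.pow_le_pow_right hl hb)]
  · simp [Trunc.mk_eq_zero_iff.2 (Ideal.pow_le_pow_right hl hc)]

/-- The map `R[G] / J ^ (2 * l) → R[G] / J ^ l ⊗ R[G] / J ^ l` induced by the comultiplication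
`g ↦ g ⊗ g`. -/
def comulTrunc (l : ℕ) : Trunc R G (2 * l) →ₐ[R] Trunc R G l ⊗[R] Trunc R G l :=
  Ideal.Quotient.liftₐ _ (comulMod l) (comulMod_eq_zero l)

theorem comulTrunc_mk (l : ℕ) (a : MonoidAlgebra R G) :
    comulTrunc l (Trunc.mk (2 * l) a) = comulMod l a := rfl

/-- The augmentation `R[G] / J → R`. -/
def counitTrunc : Trunc R G 1 →ₐ[R] R :=
  Ideal.Quotient.liftₐ _ (Bialgebra.counitAlgHom R (MonoidAlgebra R G))
    (fun a ha => by rw [Submodule.pow_one] at ha; exact ha)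

theorem counitTrunc_mk (a : MonoidAlgebra R G) :
    counitTrunc (Trunc.mk 1 a) = Bialgebra.counitAlgHom R (MonoidAlgebra R G) a := rfl

/-- The component in `R[G] / J ^ l ⊗ R[G] / J ^ l` of the comultiplication
`Δ : R[G]^ → lim (R[G] / J ^ l ⊗ R[G] / J ^ l)` of the completed group algebra. -/
def comul (l : ℕ) : Completion R G →ₐ[R] Trunc R G l ⊗[R] Trunc R G l :=
  (comulTrunc l).comp (Completion.proj (2 * l))

/-- The augmentation `ε` of the completed group algebra. -/
def counit : Completion R G →ₐ[R] R :=
  counitTrunc.comp (Completion.proj 1)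

/-- `x` is grouplike: `Δ x = x ⊗ x` in the completed tensor product
`lim (R[G] / J ^ l ⊗ R[G] / J ^ l)`, and `ε x = 1`. -/
def IsGrouplike (x : Completion R G) : Prop :=
  (∀ l, comul l x = Completion.proj l x ⊗ₜ[R] Completion.proj l x) ∧ counit x = 1

/-- Every grouplike element of the completed group algebra is a unit. -/
theorem IsGrouplike.isUnit {x : Completion R G} (hx : IsGrouplike x) : IsUnit x := by
  have hl : ∀ l, IsUnit (Completion.proj l x) := fun l => by
    obtain ⟨a, ha⟩ := Trunc.mk_surjective (l + 1) (Completion.proj (l + 1) x)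
    have ha1 : Completion.proj 1 x = Trunc.mk 1 a := by
      rw [← Completion.factor_proj (Nat.succ_le_succ (Nat.zero_le l)), ← ha, Trunc.factor_mk]
    have hal : Completion.proj l x = Trunc.mk l a := by
      rw [← Completion.factor_proj (Nat.le_succ l), ← ha, Trunc.factor_mk]
    have hJ : a - 1 ∈ augIdeal R G := by
      have h := hx.2
      rw [counit, AlgHom.comp_apply, ha1, counitTrunc_mk] at h
      rw [augIdeal, RingHom.mem_ker, map_sub, h, map_one, sub_self]
    have hpow : ∀ n, (a - 1) ^ n ∈ augIdeal R G ^ n := fun n => by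
      induction n with
      | zero => simp [Submodule.pow_zero]
      | succ n ih => rw [pow_succ, Submodule.pow_succ]; exact Ideal.mul_mem_mul ih hJ
    have hnil : IsNilpotent (Trunc.mk l (a - 1)) :=
      ⟨l, by rw [← map_pow, Trunc.mk_eq_zero_iff]; exact hpow l⟩
    rw [hal]
    simpa using hnil.isUnit_add_one
  choose u hu using hl
  have hmem : (fun l => (↑(u l)⁻¹ : Trunc R G l)) ∈ Completion R G := fun m n h => by
    have h1 : Trunc.factor h (↑(u n)⁻¹ : Trunc R G n) * (u m : Trunc R G m) = 1 := by
      rw [hu m, ← Completion.factor_proj h, ← hu n, ← map_mul, Units.inv_mul, map_one]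
    exact Units.eq_inv_of_mul_eq_one_right h1
  refine isUnit_iff_exists.2 ⟨⟨_, hmem⟩, Completion.ext fun l => ?_, Completion.ext fun l => ?_⟩
  · rw [map_mul, map_one, ← hu l]; exact Units.mul_inv _
  · rw [map_mul, map_one, ← hu l]; exact Units.inv_mul _

variable (R G) in
/-- The group `𝒫` of grouplike elements of the completed group algebra, as a subgroup of its group
of units. Every grouplike element is a unit by `IsGrouplike.isUnit`. -/
def grouplikes : Subgroup (Completion R G)ˣ where
  carrier := {x | IsGrouplike (x : Completion R G)}
  one_mem' := ⟨fun l => by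
    rw [Units.val_one, map_one, map_one, Algebra.TensorProduct.one_def],
    by rw [Units.val_one, map_one]⟩
  mul_mem' {x y} hx hy :=
    ⟨fun l => by
      rw [Units.val_mul, map_mul, hx.1, hy.1, Algebra.TensorProduct.tmul_mul_tmul, map_mul],
      by rw [Units.val_mul, map_mul, hx.2, hy.2, mul_one]⟩
  inv_mem' {x} hx := by
    constructor
    · intro l
      have h1 : comul l (↑x⁻¹ : Completion R G) * comul l (x : Completion R G) = 1 := by
        rw [← map_mul, Units.inv_mul, map_one]
      rw [hx.1] at h1
      refine left_inv_eq_right_inv h1 ?_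
      rw [Algebra.TensorProduct.tmul_mul_tmul, ← map_mul, Units.mul_inv, map_one,
        Algebra.TensorProduct.one_def]
    · have h1 : counit (↑x⁻¹ : Completion R G) * counit (x : Completion R G) = 1 := by
        rw [← map_mul, Units.inv_mul, map_one]
      rwa [hx.2, mul_one] at h1

variable (R G)

/-- The canonical algebra map `R[G] → R[G]^`. -/
def toCompletion : MonoidAlgebra R G →ₐ[R] Completion R G :=
  (AlgHom.pi fun l => Trunc.mk l).codRestrict (Completion R G) (fun _ _ _ _ => rfl)

theorem units_map_of_mem_grouplikes (g : G) :
    Units.map (toCompletion R G : MonoidAlgebra R G →* Completion R G)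
      ((MonoidAlgebra.of R G).toHomUnits g) ∈ grouplikes R G :=
  ⟨fun l => comulMod_of l g, show Bialgebra.counitAlgHom R _ (MonoidAlgebra.of R G g) = 1 by simp⟩

/-- The canonical homomorphism `g ↦ g` from `G` to the group of grouplike elements. -/
def toGrouplikes : G →* grouplikes R G :=
  ((Units.map (toCompletion R G : MonoidAlgebra R G →* Completion R G)).comp
    (MonoidAlgebra.of R G).toHomUnits).codRestrict (grouplikes R G)
      (units_map_of_mem_grouplikes R G)

section BaseChange

variable {R} {S : Type*} [CommRing S] (f : R →+* S)

theorem counit_mapRingHom (b : MonoidAlgebra R G) :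
    Bialgebra.counitAlgHom S (MonoidAlgebra S G) (MonoidAlgebra.mapRingHom G f b) =
      f (Bialgebra.counitAlgHom R (MonoidAlgebra R G) b) := by
  induction b using MonoidAlgebra.induction_linear with
  | zero => simp
  | add b c hb hc => simp only [map_add, hb, hc]
  | single g r => simp

theorem mapRingHom_mem (l : ℕ) (a : MonoidAlgebra R G) (ha : a ∈ augIdeal R G ^ l) :
    MonoidAlgebra.mapRingHom G f a ∈ augIdeal S G ^ l := by
  have hJ : ∀ b ∈ augIdeal R G, MonoidAlgebra.mapRingHom G f b ∈ augIdeal S G := fun b hb => by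
    rw [augIdeal, RingHom.mem_ker] at hb ⊢
    rw [counit_mapRingHom, hb, map_zero]
  induction l generalizing a with
  | zero => simp [Submodule.pow_zero]
  | succ n ih =>
    rw [Submodule.pow_succ] at ha ⊢
    induction ha using Submodule.mul_induction_on' with
    | add x _ y _ hx hy => rw [map_add]; exact add_mem hx hy
    | mem_mul_mem x hx y hy => rw [map_mul]; exact Ideal.mul_mem_mul (ih x hx) (hJ y hy)

/-- The map `R[G] / J ^ l → S[G] / J ^ l` induced by `f : R → S`. -/
def Trunc.map (l : ℕ) : Trunc R G l →+* Trunc S G l :=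
  Ideal.Quotient.lift _ ((Trunc.mk l : MonoidAlgebra S G →ₐ[S] Trunc S G l).toRingHom.comp
    (MonoidAlgebra.mapRingHom G f))
    (fun a ha => Trunc.mk_eq_zero_iff.2 (mapRingHom_mem G f l a ha))

theorem Trunc.map_mk (l : ℕ) (a : MonoidAlgebra R G) :
    Trunc.map G f l (Trunc.mk l a) = Trunc.mk l (MonoidAlgebra.mapRingHom G f a) := rfl

/-- The map `R[G]^ → S[G]^` induced by `f : R → S`. -/
def Completion.map : Completion R G →+* Completion S G where
  toFun x := ⟨fun l => Trunc.map G f l (proj l x), fun m n h => by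
    obtain ⟨a, ha⟩ := Trunc.mk_surjective n (proj n x)
    change Trunc.factor h (Trunc.map G f n (proj n x)) = Trunc.map G f m (proj m x)
    rw [← factor_proj h, ← ha, Trunc.factor_mk, Trunc.map_mk, Trunc.map_mk, Trunc.factor_mk]⟩
  map_one' := Completion.ext fun l => (map_one (Trunc.map G f l) :)
  map_mul' x y := Completion.ext fun l => map_mul (Trunc.map G f l) (proj l x) (proj l y)
  map_zero' := Completion.ext fun l => (map_zero (Trunc.map G f l) :)
  map_add' x y := Completion.ext fun l => map_add (Trunc.map G f l) (proj l x) (proj l y)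

theorem Completion.proj_map (l : ℕ) (x : Completion R G) :
    proj l (Completion.map G f x) = Trunc.map G f l (proj l x) := rfl

theorem exists_tensorMap (l : ℕ) : ∃ T : (Trunc R G l ⊗[R] Trunc R G l) →+
    (Trunc S G l ⊗[S] Trunc S G l), (∀ x y, T (x ⊗ₜ y) = Trunc.map G f l x ⊗ₜ Trunc.map G f l y) ∧
      ∀ r t, T (r • t) = f r • T t := by
  have hs : ∀ (r : R) (x : Trunc R G l), Trunc.map G f l (r • x) = f r • Trunc.map G f l x :=
    fun r x => by
      obtain ⟨a, rfl⟩ := Trunc.mk_surjective l x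
      rw [← map_smul, Trunc.map_mk, Trunc.map_mk, ← map_smul]
      congr 1
      induction a using MonoidAlgebra.induction_linear with
      | zero => simp
      | add a b ha hb => simp only [smul_add, map_add, ha, hb]
      | single g r => simp
  let _ : Module R (Trunc S G l ⊗[S] Trunc S G l) := Module.compHom _ f
  let B : Trunc R G l →ₗ[R] Trunc R G l →ₗ[R] (Trunc S G l ⊗[S] Trunc S G l) :=
    LinearMap.mk₂ R (fun x y => Trunc.map G f l x ⊗ₜ Trunc.map G f l y)
      (fun x x' y => by rw [map_add, TensorProduct.add_tmul])
      (fun r x y => by rw [hs]; exact (TensorProduct.smul_tmul' _ _ _).symm)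
      (fun x y y' => by rw [map_add, TensorProduct.tmul_add])
      (fun r x y => by rw [hs]; exact TensorProduct.tmul_smul _ _ _)
  exact ⟨(TensorProduct.lift B).toAddMonoidHom, fun x y => rfl,
    fun r t => (TensorProduct.lift B).map_smul r t⟩

theorem IsGrouplike.map {x : Completion R G} (hx : IsGrouplike x) :
    IsGrouplike (Completion.map G f x) := by
  constructor
  · intro l
    obtain ⟨a, ha⟩ := Trunc.mk_surjective (2 * l) (Completion.proj (2 * l) x)
    obtain ⟨T, hT⟩ := exists_tensorMap G f l
    have h := hx.1 l
    rw [comul, AlgHom.comp_apply, ← ha, comulTrunc_mk] at h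
    rw [comul, AlgHom.comp_apply, Completion.proj_map, Completion.proj_map, ← ha, Trunc.map_mk,
      comulTrunc_mk, ← hT.1, ← h]
    clear h ha
    induction a using MonoidAlgebra.induction_linear with
    | zero => simp only [map_zero]
    | add a b ha hb => simp only [map_add, ha, hb]
    | single g r =>
      have hR : MonoidAlgebra.single g r = r • MonoidAlgebra.of R G g := by simp
      have hS : MonoidAlgebra.mapRingHom G f (r • MonoidAlgebra.of R G g) =
        f r • MonoidAlgebra.of S G g := by simp
      have h1 : MonoidAlgebra.mapRingHom G f (MonoidAlgebra.of R G g) = MonoidAlgebra.of S G g := by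
        simp
      rw [hR, hS, map_smul, map_smul, hT.2, comulMod_of, comulMod_of, hT.1, Trunc.map_mk, h1]
  · obtain ⟨a, ha⟩ := Trunc.mk_surjective 1 (Completion.proj 1 x)
    have h := hx.2
    rw [counit, AlgHom.comp_apply, ← ha, counitTrunc_mk] at h
    rw [counit, AlgHom.comp_apply, Completion.proj_map, ← ha, Trunc.map_mk, counitTrunc_mk,
      counit_mapRingHom, h, map_one]

/-- The homomorphism between the groups of grouplike elements of `R[G]^` and `S[G]^` induced by
`f : R → S`. -/
def grouplikesMap : grouplikes R G →* grouplikes S G :=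
  ((Units.map (Completion.map G f : Completion R G →* Completion S G)).comp
    (grouplikes R G).subtype).codRestrict (grouplikes S G) (fun x => IsGrouplike.map G f x.2)

theorem grouplikesMap_id : grouplikesMap G (RingHom.id R) = MonoidHom.id (grouplikes R G) := by
  refine MonoidHom.ext fun x => Subtype.ext (Units.ext (Completion.ext fun l => ?_))
  change Trunc.map G (RingHom.id R) l (Completion.proj l x.1.1) = Completion.proj l x.1.1
  obtain ⟨a, ha⟩ := Trunc.mk_surjective l (Completion.proj l x.1.1)
  rw [← ha, Trunc.map_mk]
  simp

theorem grouplikesMap_comp {T : Type*} [CommRing T] (g : S →+* T) :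
    grouplikesMap G (g.comp f) = (grouplikesMap G g).comp (grouplikesMap G f) := by
  refine MonoidHom.ext fun x => Subtype.ext (Units.ext (Completion.ext fun l => ?_))
  change Trunc.map G (g.comp f) l (Completion.proj l x.1.1) =
    Trunc.map G g l (Trunc.map G f l (Completion.proj l x.1.1))
  obtain ⟨a, ha⟩ := Trunc.mk_surjective l (Completion.proj l x.1.1)
  rw [← ha, Trunc.map_mk, Trunc.map_mk, Trunc.map_mk, MonoidAlgebra.mapRingHom_comp]
  rfl

end BaseChange

end GroupAlgebra

/-! ### Prounipotent groups and unipotent completions -/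

/-- A group functor over `k`: a functor from commutative `k`-algebras to groups. Affine group
schemes over `k`, that is, proalgebraic groups over `k`, are regarded as such functors through
their functors of points, and a homomorphism of proalgebraic groups is a natural transformation. -/
abbrev GroupFunctor (k : Type u) [CommRing k] := CommAlgCat.{u} k ⥤ GrpCat.{u}

variable (k : Type u) [Field k]

/-- The group functor `GL_n` over `k`. -/
def generalLinear (n : ℕ) : GroupFunctor k where
  obj R := GrpCat.of (Matrix.GeneralLinearGroup (Fin n) R)
  map f := GrpCat.ofHom (Matrix.GeneralLinearGroup.map f.hom.toRingHom)

variable {k}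

/-- The entries of the matrix `ρ(g)`, for a representation `ρ : E ⟶ GL_n` and `g ∈ E(R)`. -/
def repMatrix {E : GroupFunctor k} {n : ℕ} (ρ : E ⟶ generalLinear k n) {R : CommAlgCat.{u} k}
    (g : E.obj R) : Matrix (Fin n) (Fin n) R :=
  (show Matrix.GeneralLinearGroup (Fin n) R from ρ.app R g).val

/-- `ρ : E ⟶ GL_n` identifies `E` with a closed subgroup of `GL_n`: it is injective on points, and
its image is the zero locus in `GL_n` of a set of polynomials over `k` in the matrix entries.
The group functors that admit such a `ρ` are the linear algebraic groups over `k`. -/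
def IsClosedEmbedding {E : GroupFunctor k} {n : ℕ} (ρ : E ⟶ generalLinear k n) : Prop :=
  ∃ S : Set (MvPolynomial (Fin n × Fin n) k), ∀ R : CommAlgCat.{u} k,
    Function.Injective (repMatrix ρ (R := R)) ∧
    ∀ M : Matrix (Fin n) (Fin n) R, M ∈ Set.range (repMatrix ρ (R := R)) ↔
      IsUnit M ∧ ∀ q ∈ S, MvPolynomial.aeval (fun p => M p.1 p.2) q = 0

/-- There is a finite filtration `k^n = V 0 ⊇ V 1 ⊇ ⋯ ⊇ V m = 0` by subspaces such that each element
of `E` acts trivially on the quotients `V i / V (i + 1)`: for each `k`-algebra `R` and `g ∈ E(R)`,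
`g v - v` lies in the extension of scalars of `V (i + 1)` to `R` for each `v` in `V i`. -/
def ActsUnipotently {E : GroupFunctor k} {n : ℕ} (ρ : E ⟶ generalLinear k n) : Prop :=
  ∃ (m : ℕ) (V : ℕ → Submodule k (Fin n → k)), V 0 = ⊤ ∧ V m = ⊥ ∧ Antitone V ∧
    ∀ (i : ℕ) (R : CommAlgCat.{u} k) (g : E.obj R), ∀ v ∈ V i,
      (repMatrix ρ g).mulVec (algebraMap k R ∘ v) - algebraMap k R ∘ v ∈
        Submodule.span R ((fun w : Fin n → k => algebraMap k R ∘ w) '' V (i + 1))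

/-- `E` is a unipotent (linear algebraic) group over `k`. -/
def IsUnipotent (E : GroupFunctor k) : Prop :=
  ∃ (n : ℕ) (ρ : E ⟶ generalLinear k n), IsClosedEmbedding ρ ∧ ActsUnipotently ρ

/-- `E` is a prounipotent group over `k`: the inverse limit of an inverse system of unipotent
groups over `k`. -/
def IsProunipotent (E : GroupFunctor k) : Prop :=
  ∃ (J : Type u) (_ : SmallCategory J) (_ : IsCofiltered J) (D : J ⥤ GroupFunctor k)
    (π : (Functor.const J).obj E ⟶ D),
    (∀ j, IsUnipotent (D.obj j)) ∧ Nonempty (Limits.IsLimit (Limits.Cone.mk E π))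

/-- The homomorphism `ψ : G → U(k)` is the unipotent `k`-completion of the group `G`: `U` is
prounipotent over `k`, and each homomorphism from `G` to (the `k`-points of) a prounipotent group
`E` over `k` factors through `ψ` by a unique homomorphism `U ⟶ E` of proalgebraic groups. -/
structure IsUnipotentCompletion {G : Type u} [Group G] (U : GroupFunctor k)
    (ψ : G →* U.obj (CommAlgCat.of k k)) : Prop where
  isProunipotent : IsProunipotent U
  existsUnique_lift : ∀ E : GroupFunctor k, IsProunipotent E →
    ∀ φ : G →* E.obj (CommAlgCat.of k k),
      ∃! Φ : U ⟶ E, ∀ g : G, Φ.app (CommAlgCat.of k k) (ψ g) = φ g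

variable (k) in
/-- The group `𝒫` of grouplike elements as a group functor over `k`: its `R`-points are the
grouplike elements of the completed group algebra `R[G]^`. In particular its `k`-points are the
grouplike elements of `k[G]^`. -/
def grouplikeFunctor (G : Type u) [Group G] : GroupFunctor k where
  obj R := GrpCat.of (grouplikes R G)
  map f := GrpCat.ofHom (grouplikesMap G f.hom.toRingHom)
  map_id R := by
    exact congrArg GrpCat.ofHom (grouplikesMap_id G)
  map_comp f g := by
    exact congrArg GrpCat.ofHom (grouplikesMap_comp G f.hom.toRingHom g.hom.toRingHom)

end

end UnipotentCompletion

namespace UnipotentCompletion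

noncomputable section

/-! ### Coefficient functions: the duals of the truncations of the group algebra. -/

section Coefficients

set_option linter.unusedSectionVars false

variable {k G : Type*} [Field k] [Group G] (R : Type*) [CommRing R] [Algebra k R]

/-! The proof reads everything off from coefficient functions. A linear form on $k[G]/J^l$ is a
function on $G$ whose linear extension kills $J^l$ (`coeffs`). Since $\Delta(J^{2l})$ vanishes in
$k[G]/J^l\otimes k[G]/J^l$, the union $O$ of these spaces over all $l$ is an algebra under pointwise
multiplication (`mul_mem_coeffs`, `coeffAlgebra`).

Modulo $J^2$ the map $g\mapsto g-1$ kills boundaries, so $J/J^2$ is a quotient of $H_1(G,k)$.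
Products of lifts of a finite spanning set span $J^n/J^{n+1}$, hence every truncation is finite
dimensional (`finiteDimensional_trunc`). Then $R[G]/J^l$ has a basis coming from $k[G]/J^l$, and its
elements are separated by coefficient functions (`truncPairing_ext`). So an element of $R[G]^\wedge$
is grouplike exactly when its components satisfy every polynomial relation over $k$ that the
coefficient functions satisfy on $G$, that is, when they are $R$-points of the Zariski closures of
$G$ (`IsGrouplike.isClosurePoint`, `isGrouplike_of_isClosurePoint`).

Each closure is a group, closed in $GL(k[G]/J^l)$ by the regular representation, and it acts
trivially on the graded pieces of the $J$-adic filtration (`isUnipotent_closureFunctor`). The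
grouplike functor is the limit of these closures, hence prounipotent.

Let $E\subset GL_n$ be unipotent and let $\phi: G\to E(k)$. Some $J^m$ acts as zero on $k^n$, so the
matrix entries of $\phi$ are coefficient functions and the representation extends to $R[G]/J^m$. The
equations of $E$ hold on $G$, hence at all grouplike elements, which gives $\Phi$ (`liftUnipotent`).
For uniqueness, there is a universal grouplike element over $O$, of which every other one is a
specialisation. A morphism is determined by its value there; the matrix entries of this value lie in
$O$, so they are functions on $G$ and are determined by their values on $G$
(`hom_ext_of_isClosedEmbedding`). A prounipotent $E$ is reached by passing to the limit. -/

theorem Trunc.linearMap_ext {R : Type*} [CommRing R] {l : ℕ} {M : Type*} [AddCommGroup M]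
    [Module R M] {φ ψ : Trunc R G l →ₗ[R] M}
    (h : ∀ g, φ (Trunc.mk l (MonoidAlgebra.of R G g)) = ψ (Trunc.mk l (MonoidAlgebra.of R G g))) :
    φ = ψ := by
  refine LinearMap.ext fun x => ?_
  obtain ⟨a, rfl⟩ := Trunc.mk_surjective l x
  induction a using MonoidAlgebra.induction_on with
  | of g => exact h g
  | add a b ha hb => simp only [map_add, ha, hb]
  | smul r a ha => simp only [map_smul, ha]

/-- The linear map on `R[G] / J ^ l` induced by a linear map on `R[G]` that kills `J ^ l`. -/
def Trunc.liftLinear {R : Type*} [CommRing R] {l : ℕ} {M : Type*} [AddCommGroup M] [Module R M]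
    (φ : MonoidAlgebra R G →ₗ[R] M) (h : ∀ a ∈ augIdeal R G ^ l, φ a = 0) :
    Trunc R G l →ₗ[R] M :=
  have key : ∀ a b, Trunc.mk l a = Trunc.mk l b → φ a = φ b := fun a b hab => by
    rw [← sub_eq_zero, ← map_sub] at hab ⊢
    exact h _ (Trunc.mk_eq_zero_iff.1 hab)
  { toFun := fun x => φ (Function.surjInv (Trunc.mk_surjective l) x)
    map_add' := fun x y => by
      rw [← map_add]
      apply key
      simp only [map_add, Function.surjInv_eq]
    map_smul' := fun r x => by
      rw [RingHom.id_apply, ← map_smul]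
      apply key
      simp only [map_smul, Function.surjInv_eq] }

theorem Trunc.liftLinear_mk {R : Type*} [CommRing R] {l : ℕ} {M : Type*} [AddCommGroup M]
    [Module R M] (φ : MonoidAlgebra R G →ₗ[R] M) (h : ∀ a ∈ augIdeal R G ^ l, φ a = 0)
    (a : MonoidAlgebra R G) : Trunc.liftLinear φ h (Trunc.mk l a) = φ a := by
  change φ (Function.surjInv (Trunc.mk_surjective l) (Trunc.mk l a)) = φ a
  rw [← sub_eq_zero, ← map_sub]
  apply h
  rw [← Trunc.mk_eq_zero_iff, map_sub, Function.surjInv_eq (Trunc.mk_surjective l), sub_self]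

theorem Trunc.map_of {R S : Type*} [CommRing R] [CommRing S] (φ : R →+* S) (l : ℕ) (g : G) :
    Trunc.map G φ l (Trunc.mk l (MonoidAlgebra.of R G g)) =
      Trunc.mk l (MonoidAlgebra.of S G g) := by
  rw [Trunc.map_mk]
  simp

theorem Trunc.map_smul {R S : Type*} [CommRing R] [CommRing S] (φ : R →+* S) (l : ℕ) (r : R)
    (x : Trunc R G l) : Trunc.map G φ l (r • x) = φ r • Trunc.map G φ l x := by
  obtain ⟨a, rfl⟩ := Trunc.mk_surjective l x
  rw [← _root_.map_smul, Trunc.map_mk, Trunc.map_mk, ← _root_.map_smul]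
  congr 1
  induction a using MonoidAlgebra.induction_linear with
  | zero => simp
  | add a b ha hb => simp only [smul_add, map_add, ha, hb]
  | single g r => simp

/-- The `R`-linear extension `R[G] → R` of a function `f : G → k`. -/
def pairing (f : G → k) : MonoidAlgebra R G →ₗ[R] R :=
  (Finsupp.linearCombination R (algebraMap k R ∘ f)).comp
    (MonoidAlgebra.coeffLinearEquiv R).toLinearMap

@[simp]
theorem pairing_single (f : G → k) (g : G) (r : R) :
    pairing R f (MonoidAlgebra.single g r) = r * algebraMap k R (f g) := by
  simp [pairing]

theorem pairing_mapRingHom {R S : Type*} [CommRing R] [CommRing S] [Algebra k R] [Algebra k S]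
    (φ : R →ₐ[k] S) (f : G → k) (a : MonoidAlgebra R G) :
    pairing S f (MonoidAlgebra.mapRingHom G φ.toRingHom a) = φ (pairing R f a) := by
  induction a using MonoidAlgebra.induction_linear with
  | zero => simp
  | add a b ha hb => simp only [map_add, ha, hb]
  | single g r => simp

theorem augIdeal_le_span {a : MonoidAlgebra R G} (ha : a ∈ augIdeal R G) :
    a ∈ Submodule.span R (MonoidAlgebra.mapRingHom G (algebraMap k R) '' (augIdeal k G)) := by
  -- Induction on the element leaves $J$, so the claim is proved for $a-\varepsilon(a)$ with $a$
  -- arbitrary.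
  suffices h : ∀ a : MonoidAlgebra R G,
      a - algebraMap R _ (Bialgebra.counitAlgHom R (MonoidAlgebra R G) a) ∈
        Submodule.span R (MonoidAlgebra.mapRingHom G (algebraMap k R) '' (augIdeal k G)) by
    have := h a
    rwa [show Bialgebra.counitAlgHom R (MonoidAlgebra R G) a = 0 from ha, map_zero,
      sub_zero] at this
  intro a
  induction a using MonoidAlgebra.induction_on with
  | of g =>
    refine Submodule.subset_span ⟨MonoidAlgebra.of k G g - 1, ?_, ?_⟩
    · simp [augIdeal, RingHom.mem_ker]
    · rw [map_sub, map_one]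
      simp [MonoidAlgebra.one_def]
  | add a b ha hb =>
    rw [map_add, map_add, add_sub_add_comm]
    exact add_mem ha hb
  | smul r a ha =>
    rw [map_smul, smul_eq_mul, map_mul, ← Algebra.smul_def, ← smul_sub]
    exact Submodule.smul_mem _ _ ha

variable (k) in
-- Because $J_R$ is spanned over $R$ by the image of $J_k$, so are the powers. A function over $k$
-- that kills $J_k^l$ therefore kills $J_R^l$, and `coeffs` over $k$ serves for every $R$.
theorem augIdeal_pow_le_span (l : ℕ) {a : MonoidAlgebra R G} (ha : a ∈ augIdeal R G ^ l) :
    a ∈ Submodule.span R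
      (MonoidAlgebra.mapRingHom G (algebraMap k R) '' (augIdeal k G ^ l : Ideal _)) := by
  induction l generalizing a with
  | zero =>
    clear ha
    induction a using MonoidAlgebra.induction_on with
    | of g => exact Submodule.subset_span ⟨MonoidAlgebra.of k G g, by simp [Submodule.pow_zero],
        by simp⟩
    | add a b ha hb =>
      exact add_mem ha hb
    | smul r a ha => exact Submodule.smul_mem _ _ ha
  | succ n ih =>
    rw [Submodule.pow_succ] at ha
    induction ha using Submodule.mul_induction_on' with
    | add x _ y _ hx hy => exact add_mem hx hy
    | mem_mul_mem x hx y hy =>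
      have h := Submodule.mul_mem_mul (ih hx) (augIdeal_le_span (k := k) R hy)
      rw [Submodule.span_mul_span] at h
      refine Submodule.span_mono ?_ h
      rintro _ ⟨_, ⟨b, hb, rfl⟩, _, ⟨c, hc, rfl⟩, rfl⟩
      refine ⟨b * c, ?_, map_mul _ _ _⟩
      rw [Submodule.pow_succ]
      exact Ideal.mul_mem_mul hb hc

variable (k G) in
/-- The functions `G → k` whose linear extension to `k[G]` vanishes on `J ^ l`. -/
def coeffs (l : ℕ) : Submodule k (G → k) where
  carrier := {f | ∀ a ∈ augIdeal k G ^ l, pairing k f a = 0}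
  zero_mem' a ha := by
    clear ha
    induction a using MonoidAlgebra.induction_linear with
    | zero => simp
    | add a b ha hb => rw [map_add, ha, hb, add_zero]
    | single g r => simp
  add_mem' {f f'} hf hf' a ha := by
    have : pairing k (f + f') a = pairing k f a + pairing k f' a := by
      clear ha
      induction a using MonoidAlgebra.induction_linear with
      | zero => simp
      | add a b ha hb => simp only [map_add, ha, hb]; abel
      | single g r => simp [mul_add]
    rw [this, hf a ha, hf' a ha, add_zero]
  smul_mem' c f hf a ha := by
    have : pairing k (c • f) a = c * pairing k f a := by
      clear ha
      induction a using MonoidAlgebra.induction_linear with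
      | zero => simp
      | add a b ha hb => simp only [map_add, ha, hb, mul_add]
      | single g r => simp [mul_left_comm]
    rw [this, hf a ha, mul_zero]

theorem pairing_eq_zero {l : ℕ} (f : coeffs k G l) {a : MonoidAlgebra R G}
    (ha : a ∈ augIdeal R G ^ l) : pairing R f.1 a = 0 := by
  have h := augIdeal_pow_le_span k R l ha
  clear ha
  induction h using Submodule.span_induction with
  | zero => simp
  | add x y _ _ hx hy => simp only [map_add, hx, hy, add_zero]
  | smul r x _ hx => simp only [map_smul, hx, smul_zero]
  | mem x hx =>
    obtain ⟨b, hb, rfl⟩ := hx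
    exact (pairing_mapRingHom (Algebra.ofId k R) f.1 b).trans (by rw [f.2 b hb, map_zero])

/-- The linear extension `R[G] / J ^ l → R` of a function `f : G → k` whose linear extension to
`k[G]` vanishes on `J ^ l`. -/
def truncPairing {l : ℕ} (f : coeffs k G l) : Trunc R G l →ₗ[R] R :=
  Trunc.liftLinear (pairing R f.1) (fun _ => pairing_eq_zero R f)

@[simp]
theorem truncPairing_of {l : ℕ} (f : coeffs k G l) (g : G) :
    truncPairing R f (Trunc.mk l (MonoidAlgebra.of R G g)) = algebraMap k R (f.1 g) := by
  rw [truncPairing, Trunc.liftLinear_mk]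
  simp

theorem truncPairing_map {R S : Type*} [CommRing R] [CommRing S] [Algebra k R] [Algebra k S]
    (φ : R →ₐ[k] S) {l : ℕ} (f : coeffs k G l) (x : Trunc R G l) :
    truncPairing S f (Trunc.map G φ.toRingHom l x) = φ (truncPairing R f x) := by
  obtain ⟨a, rfl⟩ := Trunc.mk_surjective l x
  rw [Trunc.map_mk, truncPairing, truncPairing, Trunc.liftLinear_mk, Trunc.liftLinear_mk,
    pairing_mapRingHom]

theorem truncPairing_algebraMap {l : ℕ} (f : coeffs k G l) (x : Trunc k G l) :
    truncPairing R f (Trunc.map G (algebraMap k R) l x) = algebraMap k R (truncPairing k f x) :=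
  truncPairing_map (Algebra.ofId k R) f x

theorem coeffs_mono : Monotone (coeffs k G) := fun _ _ h _ hf a ha =>
  hf a (Ideal.pow_le_pow_right h ha)

theorem truncPairing_factor {m n : ℕ} (h : m ≤ n) (f : coeffs k G m) (x : Trunc R G n) :
    truncPairing R f (Trunc.factor h x) =
      truncPairing R (⟨f.1, coeffs_mono h f.2⟩ : coeffs k G n) x := by
  have : (truncPairing R f).comp (Trunc.factor h).toLinearMap =
      truncPairing R (⟨f.1, coeffs_mono h f.2⟩ : coeffs k G n) :=
    Trunc.linearMap_ext fun g => by
      rw [LinearMap.comp_apply, AlgHom.toLinearMap_apply, Trunc.factor_mk, truncPairing_of,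
        truncPairing_of]
  exact LinearMap.congr_fun this x

/-- The function on `G` given by a linear form on `k[G] / J ^ l`. -/
def coeffOfDual {l : ℕ} (φ : Trunc k G l →ₗ[k] k) : coeffs k G l :=
  ⟨fun g => φ (Trunc.mk l (MonoidAlgebra.of k G g)), fun a ha => by
    have : ∀ b, pairing k (fun g => φ (Trunc.mk l (MonoidAlgebra.of k G g))) b =
        φ (Trunc.mk l b) := fun b => by
      induction b using MonoidAlgebra.induction_linear with
      | zero => simp
      | add a b ha hb => simp only [map_add, ha, hb]
      | single g r =>
        rw [pairing_single, ← MonoidAlgebra.smul_of, map_smul, map_smul]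
        rfl
    rw [this, Trunc.mk_eq_zero_iff.2 ha, map_zero]⟩

theorem coeffOfDual_apply {l : ℕ} (φ : Trunc k G l →ₗ[k] k) (g : G) :
    (coeffOfDual φ).1 g = φ (Trunc.mk l (MonoidAlgebra.of k G g)) := rfl

theorem truncPairing_coeffOfDual {l : ℕ} (φ : Trunc k G l →ₗ[k] k) :
    truncPairing k (coeffOfDual φ) = φ :=
  Trunc.linearMap_ext fun g => by rw [truncPairing_of]; rfl

/-- The coefficient function `g ↦ f (g * a)`. -/
def mulRightCoeff {l : ℕ} (f : coeffs k G l) (a : Trunc k G l) : coeffs k G l :=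
  coeffOfDual ((truncPairing k f).comp (LinearMap.mulRight k a))

theorem truncPairing_mulRightCoeff {l : ℕ} (f : coeffs k G l) (a : Trunc k G l)
    (x : Trunc R G l) : truncPairing R (mulRightCoeff f a) x =
      truncPairing R f (x * Trunc.map G (algebraMap k R) l a) := by
  have : truncPairing R (mulRightCoeff f a) = (truncPairing R f).comp
      (LinearMap.mulRight R (Trunc.map G (algebraMap k R) l a)) :=
    Trunc.linearMap_ext fun g => by
      rw [truncPairing_of, LinearMap.comp_apply, LinearMap.mulRight_apply,
        ← Trunc.map_of (algebraMap k R), ← map_mul, truncPairing_algebraMap]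
      rfl
  exact LinearMap.congr_fun this x

/-! ### Bases of the truncations over every algebra. -/

section Basis

variable (l : ℕ) [FiniteDimensional k (Trunc k G l)]

variable (k G) in
/-- The coordinate functions of a basis of `k[G] / J ^ l`. -/
def coordCoeff (i : Fin (Module.finrank k (Trunc k G l))) : coeffs k G l :=
  coeffOfDual ((Module.finBasis k (Trunc k G l)).coord i)

variable (k G) in
/-- The chosen basis of `k[G] / J ^ l`, in `R[G] / J ^ l`. -/
def truncVec (i : Fin (Module.finrank k (Trunc k G l))) : Trunc R G l :=
  Trunc.map G (algebraMap k R) l (Module.finBasis k (Trunc k G l) i)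

theorem truncPairing_coordCoeff_truncVec (i j : Fin (Module.finrank k (Trunc k G l))) :
    truncPairing R (coordCoeff k G l i) (truncVec k G R l j) = if i = j then 1 else 0 := by
  rw [truncVec, truncPairing_algebraMap, coordCoeff, truncPairing_coeffOfDual]
  simp [Finsupp.single_apply, eq_comm, apply_ite (algebraMap k R)]

/-- By linearity it is enough to take $x$ in $G$, where this is the image of the basis expansion
over $k$. -/
theorem sum_truncPairing_smul (x : Trunc R G l) :
    ∑ i, truncPairing R (coordCoeff k G l i) x • truncVec k G R l i = x := by
  have : (∑ i, (truncPairing R (coordCoeff k G l i)).smulRight (truncVec k G R l i)) =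
      LinearMap.id := Trunc.linearMap_ext fun g => by
    have h := congrArg (Trunc.map G (algebraMap k R) l) ((Module.finBasis k (Trunc k G l)).sum_repr
      (Trunc.mk l (MonoidAlgebra.of k G g)))
    rw [map_sum, Trunc.map_of] at h
    simp only [Trunc.map_smul] at h
    simp only [LinearMap.sum_apply, LinearMap.smulRight_apply, truncPairing_of, LinearMap.id_apply]
    exact h
  have h := LinearMap.congr_fun this x
  simpa using h

variable (k G) in
/-- The basis of `R[G] / J ^ l` obtained from the chosen basis of `k[G] / J ^ l`. -/
def truncBasis : Module.Basis (Fin (Module.finrank k (Trunc k G l))) R (Trunc R G l) :=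
  Module.Basis.mk (v := truncVec k G R l)
    (by
      rw [Fintype.linearIndependent_iff]
      intro c hc i
      have := congrArg (truncPairing R (coordCoeff k G l i)) hc
      simpa [truncPairing_coordCoeff_truncVec] using this)
    (fun x _ => by
      rw [← sum_truncPairing_smul (k := k) R l x]
      exact Submodule.sum_mem _ fun i _ => Submodule.smul_mem _ _ (Submodule.subset_span ⟨i, rfl⟩))

theorem truncBasis_apply (i) : truncBasis k G R l i = truncVec k G R l i := by
  simp [truncBasis]

theorem truncBasis_repr (x : Trunc R G l) (i) :
    (truncBasis k G R l).repr x i = truncPairing R (coordCoeff k G l i) x := by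
  conv_lhs => rw [← sum_truncPairing_smul (k := k) R l x]
  simp only [← truncBasis_apply]
  rw [Module.Basis.repr_sum_self]

variable {R l} in
theorem truncPairing_ext {x y : Trunc R G l}
    (h : ∀ f : coeffs k G l, truncPairing R f x = truncPairing R f y) : x = y := by
  rw [← sum_truncPairing_smul (k := k) R l x, ← sum_truncPairing_smul (k := k) R l y]
  simp only [h]

/-- Expanding the right factor in the basis writes $f(xy)$ as a sum of products of coefficient
functions of $x$ and $y$: multiplication is polynomial. -/
theorem truncPairing_mul (f : coeffs k G l) (x y : Trunc R G l) :
    truncPairing R f (x * y) = ∑ i, truncPairing R (coordCoeff k G l i) y *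
      truncPairing R (mulRightCoeff f (Module.finBasis k (Trunc k G l) i)) x := by
  conv_lhs => rw [← sum_truncPairing_smul (k := k) R l y]
  simp only [Finset.mul_sum, map_sum, mul_smul_comm, map_smul, smul_eq_mul,
    truncPairing_mulRightCoeff, truncVec]

end Basis

end Coefficients

/-! ### Finiteness of the truncations from finiteness of first homology. -/

section FiniteDimensional

variable {k : Type u} [Field k] {G : Type u} [Group G]

theorem of_sub_one_mem_augIdeal {R : Type*} [CommRing R] (g : G) :
    MonoidAlgebra.of R G g - 1 ∈ augIdeal R G := by
  simp [augIdeal, RingHom.mem_ker]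

theorem sub_counit_mem_span (a : MonoidAlgebra k G) :
    a - algebraMap k _ (Bialgebra.counitAlgHom k (MonoidAlgebra k G) a) ∈
      Submodule.span k (Set.range fun g : G => MonoidAlgebra.of k G g - 1) := by
  induction a using MonoidAlgebra.induction_on with
  | of g =>
    refine Submodule.subset_span ⟨g, ?_⟩
    simp [MonoidAlgebra.one_def]
  | add a b ha hb =>
    rw [map_add, map_add, add_sub_add_comm]
    exact add_mem ha hb
  | smul r a ha =>
    rw [map_smul, smul_eq_mul, map_mul, ← Algebra.smul_def, ← smul_sub]
    exact Submodule.smul_mem _ _ ha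

/-- The linear map `G →₀ k → k[G] / J ^ 2`, `g ↦ g - 1`. -/
def chainToTrunc (k G : Type u) [Field k] [Group G] : (G →₀ k) →ₗ[k] Trunc k G 2 :=
  Finsupp.linearCombination k fun g => Trunc.mk 2 (MonoidAlgebra.of k G g - 1)

/-- The boundary of $(g,h)$ goes to $(h-1)-(gh-1)+(g-1)=-(g-1)(h-1)$, which lies in $J^2$. -/
theorem chainToTrunc_d₂₁ (x : G × G →₀ k) :
    chainToTrunc k G (groupHomology.d₂₁ (Rep.trivial k G k) x) = 0 := by
  induction x using Finsupp.induction_linear with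
  | zero => simp
  | add x y hx hy => rw [map_add]; erw [map_add]; rw [hx, hy, add_zero]
  | single p r =>
    obtain ⟨g, h⟩ := p
    rw [groupHomology.d₂₁_single]
    erw [map_add, map_sub]
    simp only [chainToTrunc, Finsupp.linearCombination_single]
    change r • _ - r • _ + r • _ = _
    rw [← smul_sub, ← smul_add, ← map_sub, ← map_add]
    have : MonoidAlgebra.of k G h - 1 - (MonoidAlgebra.of k G (g * h) - 1) +
        (MonoidAlgebra.of k G g - 1) =
        -((MonoidAlgebra.of k G g - 1) * (MonoidAlgebra.of k G h - 1)) := by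
      rw [map_mul]; noncomm_ring
    rw [this, map_neg, Trunc.mk_eq_zero_iff.2, neg_zero, smul_zero]
    rw [Submodule.pow_succ, Submodule.pow_one]
    exact Ideal.mul_mem_mul (of_sub_one_mem_augIdeal g) (of_sub_one_mem_augIdeal h)

/-- With trivial coefficients every 1-chain is a cycle, so chains modulo boundaries are $H_1$, and
the range is a quotient of $H_1$ by `chainToTrunc_d₂₁`. -/
theorem finite_range_chainToTrunc
    (hH : FiniteDimensional k (groupHomology (Rep.trivial k G k) 1)) :
    FiniteDimensional k (LinearMap.range (chainToTrunc k G)) := by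
  let A := Rep.trivial k G k
  let e : (G →₀ k) ≃ₗ[k] groupHomology.cycles₁ A :=
    (LinearEquiv.ofTop _ (groupHomology.cycles₁_eq_top_of_isTrivial A)).symm
  let p : (G →₀ k) →ₗ[k] groupHomology.H1 A := (groupHomology.H1π A).hom.comp e.toLinearMap
  have hle : LinearMap.ker p ≤ LinearMap.ker (chainToTrunc k G) := fun x hx => by
    obtain ⟨y, hy⟩ := (groupHomology.H1π_eq_zero_iff (e x)).1 hx
    have : (e x).1 = x := rfl
    rw [this] at hy
    rw [LinearMap.mem_ker, ← hy]
    exact chainToTrunc_d₂₁ y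
  have : FiniteDimensional k (LinearMap.range p) :=
    @FiniteDimensional.finiteDimensional_submodule k _ _ _ _ hH _
  have : FiniteDimensional k ((G →₀ k) ⧸ LinearMap.ker p) :=
    p.quotKerEquivRange.symm.finiteDimensional
  have := Module.Finite.of_surjective _ (Submodule.factor_surjective hle)
  exact (chainToTrunc k G).quotKerEquivRange.finiteDimensional

/-- The powers of the augmentation ideal as `k`-subspaces. -/
abbrev augPow (k G : Type u) [Field k] [Group G] (n : ℕ) : Submodule k (MonoidAlgebra k G) :=
  (augIdeal k G ^ n).restrictScalars k

theorem augPow_mul_le (m n : ℕ) : augPow k G m * augPow k G n ≤ augPow k G (m + n) :=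
  Submodule.mul_le.2 fun a ha b hb => by
    change a * b ∈ augIdeal k G ^ (m + n)
    rw [Ideal.IsTwoSided.pow_add]
    exact Ideal.mul_mem_mul ha hb

theorem augPow_succ_le (n : ℕ) : augPow k G (n + 1) ≤ augPow k G n * augPow k G 1 := fun a ha => by
  change a ∈ augIdeal k G ^ (n + 1) at ha
  rw [Submodule.pow_succ] at ha
  induction ha using Submodule.mul_induction_on' with
  | add x _ y _ hx hy => exact add_mem hx hy
  | mem_mul_mem x hx y hy =>
    exact Submodule.mul_mem_mul hx (show y ∈ augIdeal k G ^ 1 by rwa [Submodule.pow_one])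

/-- The range of `chainToTrunc` is the image of $J$ in $k[G]/J^2$; $W$ is spanned by lifts to $J$ of
a finite spanning set. -/
theorem exists_fg_sup_augPow_two
    (hH : FiniteDimensional k (groupHomology (Rep.trivial k G k) 1)) :
    ∃ W : Submodule k (MonoidAlgebra k G), W.FG ∧ W ≤ augPow k G 1 ∧
      augPow k G 1 ≤ W ⊔ augPow k G 2 := by
  have hfin := finite_range_chainToTrunc hH
  have hJ : augPow k G 1 ≤ Submodule.span k (Set.range fun g : G => MonoidAlgebra.of k G g - 1) :=
    fun a ha => by
      have h := sub_counit_mem_span a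
      change a ∈ augIdeal k G ^ 1 at ha
      rw [Submodule.pow_one] at ha
      rwa [show Bialgebra.counitAlgHom k (MonoidAlgebra k G) a = 0 from ha, map_zero,
        sub_zero] at h
  have hJ' : Submodule.span k (Set.range fun g : G => MonoidAlgebra.of k G g - 1) ≤ augPow k G 1 :=
    Submodule.span_le.2 <| by
      rintro _ ⟨g, rfl⟩
      change _ ∈ augIdeal k G ^ 1
      rw [Submodule.pow_one]
      exact of_sub_one_mem_augIdeal g
  have hmap : (augPow k G 1).map (Trunc.mk 2).toLinearMap = LinearMap.range (chainToTrunc k G) := by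
    rw [le_antisymm hJ hJ', Submodule.map_span, chainToTrunc, Finsupp.range_linearCombination,
      ← Set.range_comp]
    rfl
  obtain ⟨s, hs⟩ := (Submodule.fg_iff_finiteDimensional _).2 hfin
  have hsub : (s : Set (Trunc k G 2)) ⊆ (Trunc.mk 2).toLinearMap '' (augPow k G 1) := by
    rw [← Submodule.map_coe, hmap, ← hs]
    exact Submodule.subset_span
  classical
  obtain ⟨t, ht, rfl⟩ := Finset.subset_set_image_iff.1 hsub
  refine ⟨Submodule.span k t, ⟨t, rfl⟩, Submodule.span_le.2 ht, fun a ha => ?_⟩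
  have h : (Trunc.mk 2).toLinearMap a ∈
      (Submodule.span k (t : Set _)).map (Trunc.mk 2).toLinearMap := by
    rw [Submodule.map_span, ← Finset.coe_image, hs, ← hmap]
    exact Submodule.mem_map_of_mem ha
  obtain ⟨w, hw, hwa⟩ := h
  refine Submodule.mem_sup.2 ⟨w, hw, a - w, ?_, add_sub_cancel _ _⟩
  change a - w ∈ augIdeal k G ^ 2
  rw [← Trunc.mk_eq_zero_iff, map_sub, sub_eq_zero]
  exact hwa.symm

/-- Inductively $J^{n+1}=J^n J\subseteq (W^n+J^{n+1})(W+J^2)$, and every product except $W^{n+1}$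
falls in $J^{n+2}$. -/
theorem augPow_le_pow_sup {W : Submodule k (MonoidAlgebra k G)} (hW : W ≤ augPow k G 1)
    (hJ : augPow k G 1 ≤ W ⊔ augPow k G 2) (n : ℕ) :
    augPow k G n ≤ W ^ n ⊔ augPow k G (n + 1) := by
  have hWn : ∀ n, W ^ n ≤ augPow k G n := fun n => by
    induction n with
    | zero =>
      intro a _
      change a ∈ augIdeal k G ^ 0
      simp [Submodule.pow_zero]
    | succ n ih =>
      rw [pow_succ]
      exact (mul_le_mul' ih hW).trans (augPow_mul_le n 1)
  induction n with
  | zero =>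
    intro a _
    -- Here $W^0$ is the line of scalars, and $a=\varepsilon(a)+(a-\varepsilon(a))$.
    refine Submodule.mem_sup.2 ⟨algebraMap k _ (Bialgebra.counitAlgHom k (MonoidAlgebra k G) a),
      ?_, a - algebraMap k _ (Bialgebra.counitAlgHom k (MonoidAlgebra k G) a), ?_,
      add_sub_cancel _ _⟩
    · rw [pow_zero]
      exact Submodule.algebraMap_mem _
    · change _ ∈ augIdeal k G ^ (0 + 1)
      rw [zero_add, Submodule.pow_one, augIdeal, RingHom.mem_ker, map_sub]
      exact sub_eq_zero.2 (AlgHom.commutes (Bialgebra.counitAlgHom k (MonoidAlgebra k G)) _).symm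
  | succ n ih =>
    refine (augPow_succ_le n).trans ((mul_le_mul' ih hJ).trans ?_)
    rw [Submodule.sup_mul, Submodule.mul_sup, Submodule.mul_sup, ← pow_succ]
    refine sup_le (sup_le_sup le_rfl ?_) (sup_le ?_ ?_)
    · exact (mul_le_mul' (hWn n) le_rfl).trans (augPow_mul_le n 2)
    · exact ((mul_le_mul' le_rfl hW).trans (augPow_mul_le (n + 1) 1)).trans le_sup_right
    · refine ((augPow_mul_le (n + 1) 2).trans fun a ha => ?_).trans le_sup_right
      exact Ideal.pow_le_pow_right (show n + 1 + 1 ≤ n + 1 + 2 by omega) ha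

/-- If `H₁(G, k)` is finite dimensional, then so are the truncations `k[G] / J ^ l`. -/
theorem finiteDimensional_trunc
    (hH : FiniteDimensional k (groupHomology (Rep.trivial k G k) 1)) (l : ℕ) :
    FiniteDimensional k (Trunc k G l) := by
  obtain ⟨W, hWfg, hW, hJ⟩ := exists_fg_sup_augPow_two hH
  obtain ⟨V, hV, hVl⟩ : ∃ V : Submodule k (MonoidAlgebra k G), V.FG ∧ ⊤ ≤ V ⊔ augPow k G l := by
    induction l with
    | zero =>
      refine ⟨⊥, Submodule.fg_bot, fun a _ => Submodule.mem_sup_right ?_⟩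
      change a ∈ augIdeal k G ^ 0
      simp [Submodule.pow_zero]
    | succ n ih =>
      obtain ⟨V, hV, hVn⟩ := ih
      refine ⟨V ⊔ W ^ n, hV.sup (hWfg.pow n), hVn.trans ?_⟩
      rw [sup_assoc]
      exact sup_le_sup le_rfl (augPow_le_pow_sup hW hJ n)
  have hmap : V.map (Trunc.mk l).toLinearMap = ⊤ := by
    refine eq_top_iff.2 fun x _ => ?_
    obtain ⟨a, rfl⟩ := Trunc.mk_surjective l x
    obtain ⟨v, hv, b, hb, rfl⟩ := Submodule.mem_sup.1 (hVl (Submodule.mem_top (x := a)))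
    refine ⟨v, hv, ?_⟩
    rw [map_add, Trunc.mk_eq_zero_iff.2 hb, add_zero]
    rfl
  exact ⟨hmap ▸ hV.map _⟩

end FiniteDimensional

/-! ### Polynomial relations and extension of the coefficient field. -/

section PolynomialExtension

variable {k R : Type*} [Field k] [CommRing R] [Algebra k R] {σ : Type*}

theorem exists_basis_decomposition {β : Type*} (b : Module.Basis β k R) (p : MvPolynomial σ R) :
    ∃ c : β →₀ MvPolynomial σ k,
      p = c.sum fun i q => MvPolynomial.C (b i) * MvPolynomial.map (algebraMap k R) q := by
  induction p using MvPolynomial.induction_on' with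
  | monomial m r =>
    refine ⟨(b.repr r).mapRange (MvPolynomial.monomial m) (map_zero _), ?_⟩
    rw [Finsupp.sum_mapRange_index (by simp)]
    conv_lhs => rw [← b.linearCombination_repr r, Finsupp.linearCombination_apply, Finsupp.sum,
      map_sum]
    refine Finset.sum_congr rfl fun i _ => ?_
    dsimp only
    rw [MvPolynomial.map_monomial, MvPolynomial.C_mul_monomial, Algebra.smul_def, mul_comm]
  | add p q hp hq =>
    obtain ⟨c, rfl⟩ := hp
    obtain ⟨d, rfl⟩ := hq
    refine ⟨c + d, ?_⟩
    classical
    rw [Finsupp.sum_add_index']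
    · simp
    · simp [mul_add]

/-- If every polynomial over `k` that vanishes on a set of `k`-points vanishes at `y : σ → R`, then
so does every polynomial over `R` that vanishes on this set. -/
theorem eval_eq_zero_of_forall_aeval_eq_zero {ι : Type*} (pts : ι → σ → k) (y : σ → R)
    (h : ∀ q : MvPolynomial σ k, (∀ i, MvPolynomial.aeval (pts i) q = 0) →
      MvPolynomial.aeval y q = 0)
    (p : MvPolynomial σ R)
    (hp : ∀ i, MvPolynomial.eval (fun s => algebraMap k R (pts i s)) p = 0) :
    MvPolynomial.eval y p = 0 := by
  let b := Module.Basis.ofVectorSpace k R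
  obtain ⟨c, rfl⟩ := exists_basis_decomposition b p
  have hc : ∀ j ∈ c.support, MvPolynomial.aeval y (c j) = 0 := fun j _ => by
    refine h _ fun i => ?_
    have hi := hp i
    rw [Finsupp.sum, map_sum] at hi
    -- At a $k$-point the vanishing of $p$ is a $k$-linear relation between basis elements of $R$,
    -- so each component $c_j$ vanishes there separately.
    have : ∑ j ∈ c.support, MvPolynomial.aeval (pts i) (c j) • b j = 0 := by
      rw [← hi]
      refine Finset.sum_congr rfl fun j _ => ?_
      rw [map_mul, MvPolynomial.eval_C, MvPolynomial.eval_map, Algebra.smul_def, mul_comm]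
      congr 1
      rw [MvPolynomial.aeval_def, MvPolynomial.hom_eval₂]
      rfl
    by_cases hj : j ∈ c.support
    · exact linearIndependent_iff'.1 b.linearIndependent c.support _ this j hj
    · rw [Finsupp.notMem_support_iff.1 hj, map_zero]
  rw [Finsupp.sum, map_sum]
  refine Finset.sum_eq_zero fun j hj => ?_
  rw [map_mul, MvPolynomial.eval_map, ← MvPolynomial.aeval_def, hc j hj, mul_zero]

end PolynomialExtension

/-! ### The antipode on the truncations. -/

section Antipode

variable {R G : Type*} [CommRing R] [Group G]

theorem antipode_mul (a b : MonoidAlgebra R G) :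
    HopfAlgebra.antipode R (a * b) = HopfAlgebra.antipode R b * HopfAlgebra.antipode R a := by
  induction a using MonoidAlgebra.induction_linear with
  | zero => simp
  | add a a' ha ha' => simp only [add_mul, mul_add, map_add, ha, ha']
  | single g r =>
    induction b using MonoidAlgebra.induction_linear with
    | zero => simp
    | add b b' hb hb' => simp only [add_mul, mul_add, map_add, hb, hb']
    | single h s => simp [MonoidAlgebra.single_mul_single, mul_comm]

theorem antipode_mem_augIdeal_pow (l : ℕ) {a : MonoidAlgebra R G} (ha : a ∈ augIdeal R G ^ l) :
    HopfAlgebra.antipode R a ∈ augIdeal R G ^ l := by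
  have hJ : ∀ b ∈ augIdeal R G, HopfAlgebra.antipode R b ∈ augIdeal R G := fun b hb => by
    have : ∀ b : MonoidAlgebra R G, Bialgebra.counitAlgHom R _ (HopfAlgebra.antipode R b) =
        Bialgebra.counitAlgHom R _ b := fun b => by
      induction b using MonoidAlgebra.induction_linear with
      | zero => simp
      | add a b ha hb => simp only [map_add, ha, hb]
      | single g r => simp
    exact (this b).trans hb
  induction l generalizing a with
  | zero => simp [Submodule.pow_zero]
  | succ n ih =>
    rw [Submodule.pow_succ] at ha
    induction ha using Submodule.mul_induction_on' with
    | add x _ y _ hx hy => rw [map_add]; exact add_mem hx hy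
    | mem_mul_mem x hx y hy =>
      rw [antipode_mul, Ideal.IsTwoSided.pow_succ]
      exact Ideal.mul_mem_mul (hJ y hy) (ih hx)

/-- The map `R[G] / J ^ l → R[G] / J ^ l` induced by `g ↦ g⁻¹`. -/
def Trunc.antipode (l : ℕ) : Trunc R G l →ₗ[R] Trunc R G l :=
  Trunc.liftLinear ((Trunc.mk l).toLinearMap.comp (HopfAlgebra.antipode R))
    fun a ha => by
      rw [LinearMap.comp_apply]
      exact Trunc.mk_eq_zero_iff.2 (antipode_mem_augIdeal_pow l ha)

theorem Trunc.antipode_of (l : ℕ) (g : G) : Trunc.antipode l (Trunc.mk l (MonoidAlgebra.of R G g)) =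
    Trunc.mk l (MonoidAlgebra.of R G g⁻¹) := by
  rw [Trunc.antipode, Trunc.liftLinear_mk, LinearMap.comp_apply, AlgHom.toLinearMap_apply]
  simp

theorem Trunc.antipode_antipode {l : ℕ} (x : Trunc R G l) :
    Trunc.antipode l (Trunc.antipode l x) = x := by
  have : (Trunc.antipode l).comp (Trunc.antipode l) = LinearMap.id (R := R) (M := Trunc R G l) :=
    Trunc.linearMap_ext fun g => by
      rw [LinearMap.comp_apply, Trunc.antipode_of, Trunc.antipode_of, inv_inv, LinearMap.id_apply]
  exact LinearMap.congr_fun this x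

end Antipode

/-! ### The Zariski closure of the group in a truncation is a group. -/

section Closure

set_option linter.unusedSectionVars false

variable (k : Type*) {G R : Type*} [Field k] [Group G] [CommRing R] [Algebra k R] {l : ℕ}

/-- `x` is an `R`-point of the Zariski closure of (the image of) `G` in `k[G] / J ^ l`. -/
def IsClosurePoint (x : Trunc R G l) : Prop :=
  ∀ q : MvPolynomial (coeffs k G l) k, (∀ g, MvPolynomial.aeval (fun f => f.1 g) q = 0) →
    MvPolynomial.aeval (fun f => truncPairing R f x) q = 0

variable {k}

theorem aeval_truncPairing_of (q : MvPolynomial (coeffs k G l) k) (g : G) :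
    MvPolynomial.aeval
      (fun f => truncPairing R f (Trunc.mk l (MonoidAlgebra.of R G g))) q =
      algebraMap k R (MvPolynomial.aeval (fun f => f.1 g) q) := by
  simp only [truncPairing_of]
  exact (MvPolynomial.aeval_algebraMap_apply R (fun f : coeffs k G l => f.1 g) q)

theorem isClosurePoint_of (g : G) : IsClosurePoint k (Trunc.mk l (MonoidAlgebra.of R G g)) :=
  fun q hq => by rw [aeval_truncPairing_of, hq, map_zero]

theorem IsClosurePoint.map {S : Type*} [CommRing S] [Algebra k S] (φ : R →ₐ[k] S)
    {x : Trunc R G l} (hx : IsClosurePoint k x) :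
    IsClosurePoint k (Trunc.map G φ.toRingHom l x) := fun q hq => by
  simp only [truncPairing_map]
  rw [← MvPolynomial.comp_aeval_apply, hx q hq, map_zero]

/-- The coefficient function `h ↦ f (g * h)`. -/
def mulLeftCoeff (f : coeffs k G l) (g : G) : coeffs k G l :=
  coeffOfDual ((truncPairing k f).comp (LinearMap.mulLeft k (Trunc.mk l (MonoidAlgebra.of k G g))))

theorem truncPairing_mulLeftCoeff (f : coeffs k G l) (g : G) (x : Trunc R G l) :
    truncPairing R (mulLeftCoeff f g) x =
      truncPairing R f (Trunc.mk l (MonoidAlgebra.of R G g) * x) := by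
  have : truncPairing R (mulLeftCoeff f g) = (truncPairing R f).comp
      (LinearMap.mulLeft R (Trunc.mk l (MonoidAlgebra.of R G g))) :=
    Trunc.linearMap_ext fun h => by
      rw [truncPairing_of, LinearMap.comp_apply, LinearMap.mulLeft_apply, ← map_mul, ← map_mul,
        truncPairing_of, mulLeftCoeff, coeffOfDual_apply, LinearMap.comp_apply,
        LinearMap.mulLeft_apply, ← map_mul, ← map_mul, truncPairing_of]
      rfl
  exact LinearMap.congr_fun this x

/-- The coefficient function `g ↦ f g⁻¹`. -/
def invCoeff (f : coeffs k G l) : coeffs k G l :=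
  coeffOfDual ((truncPairing k f).comp (Trunc.antipode l))

theorem invCoeff_apply (f : coeffs k G l) (g : G) : (invCoeff f).1 g = f.1 g⁻¹ := by
  rw [invCoeff, coeffOfDual_apply, LinearMap.comp_apply, Trunc.antipode_of, truncPairing_of]
  rfl

theorem truncPairing_invCoeff (f : coeffs k G l) (x : Trunc R G l) :
    truncPairing R (invCoeff f) x = truncPairing R f (Trunc.antipode l x) := by
  have : truncPairing R (invCoeff f) = (truncPairing R f).comp (Trunc.antipode l) :=
    Trunc.linearMap_ext fun g => by
      rw [truncPairing_of, LinearMap.comp_apply, Trunc.antipode_of, truncPairing_of,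
        invCoeff_apply]
  exact LinearMap.congr_fun this x

theorem IsClosurePoint.antipode {x : Trunc R G l} (hx : IsClosurePoint k x) :
    IsClosurePoint k (Trunc.antipode l x) := fun q hq => by
  have := hx (MvPolynomial.rename invCoeff q) fun g => by
    rw [MvPolynomial.aeval_rename, ← hq g⁻¹]
    congr 2
    funext f
    exact invCoeff_apply f g
  rw [MvPolynomial.aeval_rename] at this
  simpa only [Function.comp_def, truncPairing_invCoeff] using this

/-- Left translation by $g$ preserves $G$ and carries coefficient functions to coefficient
functions, so it can be substituted into the relation $q$. -/
theorem IsClosurePoint.of_mul (g : G) {x : Trunc R G l} (hx : IsClosurePoint k x) :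
    IsClosurePoint k (Trunc.mk l (MonoidAlgebra.of R G g) * x) := fun q hq => by
  have := hx (MvPolynomial.rename (mulLeftCoeff · g) q) fun h => by
    rw [MvPolynomial.aeval_rename, ← hq (g * h)]
    congr 2
    funext f
    have := truncPairing_mulLeftCoeff f g (Trunc.mk l (MonoidAlgebra.of k G h))
    rw [← map_mul, ← map_mul, truncPairing_of, truncPairing_of] at this
    exact this
  rw [MvPolynomial.aeval_rename] at this
  simpa only [Function.comp_def, truncPairing_mulLeftCoeff] using this

variable [FiniteDimensional k (Trunc k G l)]

/-- For fixed $y$ the condition $q(zy)=0$ is polynomial in $z$, though with coefficients in $R$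
rather than $k$. It holds for $z$ in $G$ by `IsClosurePoint.of_mul`, and
`eval_eq_zero_of_forall_aeval_eq_zero` carries it to $z=x$. -/
theorem IsClosurePoint.mul {x y : Trunc R G l} (hx : IsClosurePoint k x)
    (hy : IsClosurePoint k y) : IsClosurePoint k (x * y) := fun q hq => by
  let p : MvPolynomial (coeffs k G l) R := MvPolynomial.aeval (fun f =>
    ∑ i, MvPolynomial.C (truncPairing R (coordCoeff k G l i) y) *
      MvPolynomial.X (mulRightCoeff f (Module.finBasis k (Trunc k G l) i))) q
  have hp : ∀ z : Trunc R G l, MvPolynomial.eval (fun f => truncPairing R f z) p =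
      MvPolynomial.aeval (fun f => truncPairing R f (z * y)) q := fun z => by
    have h := MvPolynomial.comp_aeval_apply (R := k) (fun f : coeffs k G l =>
      ∑ i, MvPolynomial.C (truncPairing R (coordCoeff k G l i) y) *
        MvPolynomial.X (mulRightCoeff f (Module.finBasis k (Trunc k G l) i)))
      ((MvPolynomial.aeval (R := R) (fun f : coeffs k G l => truncPairing R f z)).restrictScalars k)
      q
    refine h.trans ?_
    congr 2
    funext f
    simp [truncPairing_mul]
  rw [← hp]
  refine eval_eq_zero_of_forall_aeval_eq_zero (fun (g : G) (f : coeffs k G l) => f.1 g) _ hx p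
    fun g => ?_
  have := hp (Trunc.mk l (MonoidAlgebra.of R G g))
  simp only [truncPairing_of] at this
  rw [this]
  exact hy.of_mul g q hq

/-- By `truncPairing_mul`, the identity $f(gg^{-1})=f(1)$ is a polynomial relation between
coefficient functions on $G$, so it persists at $x$. -/
theorem IsClosurePoint.mul_antipode {x : Trunc R G l} (hx : IsClosurePoint k x) :
    x * Trunc.antipode l x = 1 := by
  refine truncPairing_ext (k := k) fun f => ?_
  have h := hx (∑ i, MvPolynomial.X (invCoeff (coordCoeff k G l i)) *
      MvPolynomial.X (mulRightCoeff f (Module.finBasis k (Trunc k G l) i)) -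
      MvPolynomial.C (f.1 1)) fun g => by
    have := truncPairing_mul k l f (Trunc.mk l (MonoidAlgebra.of k G g))
      (Trunc.mk l (MonoidAlgebra.of k G g⁻¹))
    rw [← map_mul, ← map_mul, mul_inv_cancel] at this
    simp only [truncPairing_of, Algebra.algebraMap_self, RingHom.id_apply] at this
    rw [this]
    simp [invCoeff_apply]
  have h1 : truncPairing R f 1 = algebraMap k R (f.1 1) := by
    rw [← truncPairing_of R f 1, map_one (MonoidAlgebra.of R G), map_one (Trunc.mk l)]
  rw [truncPairing_mul, h1]
  simpa [truncPairing_invCoeff, sub_eq_zero] using h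

theorem IsClosurePoint.antipode_mul {x : Trunc R G l} (hx : IsClosurePoint k x) :
    Trunc.antipode l x * x = 1 := by
  simpa only [Trunc.antipode_antipode] using hx.antipode.mul_antipode

variable (k G R l) in
/-- The `R`-points of the Zariski closure of `G` in the group of units of `k[G] / J ^ l`. -/
def closurePoints : Subgroup (Trunc R G l)ˣ where
  carrier := {x | IsClosurePoint k (x : Trunc R G l)}
  one_mem' := by
    have := isClosurePoint_of (k := k) (R := R) (l := l) (1 : G)
    rwa [map_one, map_one] at this
  mul_mem' hx hy := hx.mul hy
  inv_mem' {x} hx := by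
    have : (↑x⁻¹ : Trunc R G l) = Trunc.antipode l x :=
      (Units.eq_inv_of_mul_eq_one_right hx.antipode_mul).symm
    change IsClosurePoint k (↑x⁻¹ : Trunc R G l)
    rw [this]
    exact hx.antipode

/-- A point of the closure, as an element of the group of points. -/
def IsClosurePoint.toUnit {x : Trunc R G l} (hx : IsClosurePoint k x) : closurePoints k G R l :=
  ⟨⟨x, Trunc.antipode l x, hx.mul_antipode, hx.antipode_mul⟩, hx⟩

/-- The map on points of the closure induced by a homomorphism of `k`-algebras. -/
def closureMap {S : Type*} [CommRing S] [Algebra k S] (φ : R →ₐ[k] S) :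
    closurePoints k G R l →* closurePoints k G S l :=
  ((Units.map (Trunc.map G φ.toRingHom l : Trunc R G l →* Trunc S G l)).comp
    (closurePoints k G R l).subtype).codRestrict (closurePoints k G S l)
      (fun x => IsClosurePoint.map φ x.2)

end Closure

/-! ### The coefficient algebra; grouplike elements as closure points. -/

section CoefficientAlgebra

set_option linter.unusedSectionVars false

variable {k G : Type*} [Field k] [Group G] (R : Type*) [CommRing R] [Algebra k R]

/-- The bilinear pairing of `R[G] / J ^ l ⊗ R[G] / J ^ l` with pairs of coefficient functions. -/
def tensorPairing {l : ℕ} (f f' : coeffs k G l) : Trunc R G l ⊗[R] Trunc R G l →ₗ[R] R :=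
  (LinearMap.mul' R R).comp (TensorProduct.map (truncPairing R f) (truncPairing R f'))

@[simp]
theorem tensorPairing_tmul {l : ℕ} (f f' : coeffs k G l) (x y : Trunc R G l) :
    tensorPairing R f f' (x ⊗ₜ y) = truncPairing R f x * truncPairing R f' y := by
  simp [tensorPairing]

/-- Since $\Delta g=g\otimes g$, comultiplication is dual to pointwise multiplication of functions.
-/
theorem tensorPairing_comulMod {l : ℕ} (f f' : coeffs k G l) (a : MonoidAlgebra R G) :
    tensorPairing R f f' (comulMod l a) = pairing R (f.1 * f'.1) a := by
  induction a using MonoidAlgebra.induction_on with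
  | of g => simp [comulMod_of, -MonoidAlgebra.of_apply]; simp
  | add a b ha hb => simp only [map_add, ha, hb]
  | smul r a ha => simp only [map_smul, ha]

/-- The level doubles because $\Delta$ is only known to kill $J^{2l}$ in the tensor square of level
$l$. -/
theorem mul_mem_coeffs {l : ℕ} {f f' : G → k} (hf : f ∈ coeffs k G l) (hf' : f' ∈ coeffs k G l) :
    f * f' ∈ coeffs k G (2 * l) := fun a ha => by
  rw [← tensorPairing_comulMod k (⟨f, hf⟩ : coeffs k G l) ⟨f', hf'⟩, comulMod_eq_zero l a ha,
    map_zero]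

theorem truncPairing_mul_eq {l : ℕ} (f f' : coeffs k G l) (x : Trunc R G (2 * l)) :
    truncPairing R (⟨f.1 * f'.1, mul_mem_coeffs f.2 f'.2⟩ : coeffs k G (2 * l)) x =
      tensorPairing R f f' (comulTrunc l x) := by
  obtain ⟨a, rfl⟩ := Trunc.mk_surjective _ x
  rw [comulTrunc_mk, tensorPairing_comulMod, truncPairing, Trunc.liftLinear_mk]

theorem pairing_one (a : MonoidAlgebra R G) :
    pairing R (1 : G → k) a = Bialgebra.counitAlgHom R (MonoidAlgebra R G) a := by
  induction a using MonoidAlgebra.induction_linear with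
  | zero => simp
  | add a b ha hb => simp only [map_add, ha, hb]
  | single g r => simp

theorem one_mem_coeffs {l : ℕ} (hl : 1 ≤ l) : (1 : G → k) ∈ coeffs k G l := fun a ha => by
  have : a ∈ augIdeal k G ^ 1 := Ideal.pow_le_pow_right hl ha
  rw [Submodule.pow_one] at this
  exact (pairing_one k a).trans this

theorem truncPairing_one (x : Trunc R G 1) :
    truncPairing R (⟨1, one_mem_coeffs le_rfl⟩ : coeffs k G 1) x = counitTrunc x := by
  obtain ⟨a, rfl⟩ := Trunc.mk_surjective _ x
  rw [counitTrunc_mk, truncPairing, Trunc.liftLinear_mk, pairing_one]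

theorem truncPairing_add {l : ℕ} (f f' : coeffs k G l) (x : Trunc R G l) :
    truncPairing R (f + f') x = truncPairing R f x + truncPairing R f' x := by
  have : truncPairing R (f + f') = truncPairing R f + truncPairing R f' :=
    Trunc.linearMap_ext fun g => by
      rw [LinearMap.add_apply, truncPairing_of, truncPairing_of, truncPairing_of, ← map_add]
      rfl
  exact LinearMap.congr_fun this x

theorem truncPairing_smul {l : ℕ} (c : k) (f : coeffs k G l) (x : Trunc R G l) :
    truncPairing R (c • f) x = c • truncPairing R f x := by
  have : truncPairing R (c • f) = algebraMap k R c • truncPairing R f :=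
    Trunc.linearMap_ext fun g => by
      rw [LinearMap.smul_apply, truncPairing_of, truncPairing_of, smul_eq_mul, ← map_mul]
      rfl
  rw [this, LinearMap.smul_apply, algebraMap_smul]

variable (k G) in
/-- The algebra of functions on `G` that extend to linear forms on some truncation of `k[G]`. It is
the coordinate ring of the group functor of grouplike elements. -/
def coeffAlgebra : Subalgebra k (G → k) where
  carrier := {f | ∃ l, f ∈ coeffs k G l}
  mul_mem' := by
    rintro f f' ⟨m, hm⟩ ⟨n, hn⟩
    exact ⟨_, mul_mem_coeffs (coeffs_mono (le_max_left m n) hm)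
      (coeffs_mono (le_max_right m n) hn)⟩
  add_mem' := by
    rintro f f' ⟨m, hm⟩ ⟨n, hn⟩
    exact ⟨_, add_mem (coeffs_mono (le_max_left m n) hm) (coeffs_mono (le_max_right m n) hn)⟩
  algebraMap_mem' c := ⟨1, by
    rw [Algebra.algebraMap_eq_smul_one]
    exact Submodule.smul_mem _ _ (one_mem_coeffs le_rfl)⟩

/-- A coefficient function, as an element of the coefficient algebra. -/
def toCoeffAlgebra {l : ℕ} (f : coeffs k G l) : coeffAlgebra k G := ⟨f.1, l, f.2⟩

variable {R}

/-- The value of a function in the coefficient algebra at an element of `R[G]^`. -/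
def coeffEval (x : Completion R G) (f : coeffAlgebra k G) : R :=
  truncPairing R (⟨f.1, f.2.choose_spec⟩ : coeffs k G f.2.choose) (Completion.proj _ x)

theorem truncPairing_proj_of_le (x : Completion R G) {m n : ℕ} (h : m ≤ n) (f : coeffs k G m) :
    truncPairing R (⟨f.1, coeffs_mono h f.2⟩ : coeffs k G n) (Completion.proj n x) =
      truncPairing R f (Completion.proj m x) := by
  rw [← truncPairing_factor R h, Completion.factor_proj]

/-- `coeffEval` uses a chosen level; the compatibility of the components of $x$ makes the value
independent of the choice. -/
theorem coeffEval_toCoeffAlgebra (x : Completion R G) {l : ℕ} (f : coeffs k G l) :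
    coeffEval x (toCoeffAlgebra f) = truncPairing R f (Completion.proj l x) := by
  rcases le_total (toCoeffAlgebra f).2.choose l with h | h
  · exact (truncPairing_proj_of_le x h _).symm
  · exact truncPairing_proj_of_le x h f

/-- A grouplike element of `R[G]^` as a homomorphism from the coefficient algebra to `R`. -/
def grouplikeHom {x : Completion R G} (hx : IsGrouplike x) : coeffAlgebra k G →ₐ[k] R :=
  AlgHom.ofLinearMap
    { toFun := coeffEval x
      map_add' := by
        rintro ⟨f, m, hm⟩ ⟨f', n, hn⟩
        let F : coeffs k G (max m n) := ⟨f, coeffs_mono (le_max_left m n) hm⟩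
        let F' : coeffs k G (max m n) := ⟨f', coeffs_mono (le_max_right m n) hn⟩
        have h := truncPairing_add R F F' (Completion.proj _ x)
        rw [← coeffEval_toCoeffAlgebra, ← coeffEval_toCoeffAlgebra,
          ← coeffEval_toCoeffAlgebra] at h
        exact h
      map_smul' := by
        rintro c ⟨f, m, hm⟩
        have h := truncPairing_smul R c (⟨f, hm⟩ : coeffs k G m) (Completion.proj _ x)
        rw [← coeffEval_toCoeffAlgebra, ← coeffEval_toCoeffAlgebra] at h
        exact h }
    (by
      have h := truncPairing_one (k := k) R (Completion.proj 1 x)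
      rw [← coeffEval_toCoeffAlgebra] at h
      exact h.trans hx.2)
    (by
      rintro ⟨f, m, hm⟩ ⟨f', n, hn⟩
      let F : coeffs k G (max m n) := ⟨f, coeffs_mono (le_max_left m n) hm⟩
      let F' : coeffs k G (max m n) := ⟨f', coeffs_mono (le_max_right m n) hn⟩
      have h := truncPairing_mul_eq R F F' (Completion.proj _ x)
      have hc : comulTrunc (max m n) (Completion.proj _ x) = _ := hx.1 (max m n)
      rw [hc, tensorPairing_tmul, ← coeffEval_toCoeffAlgebra,
        ← coeffEval_toCoeffAlgebra, ← coeffEval_toCoeffAlgebra] at h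
      exact h)

theorem grouplikeHom_toCoeffAlgebra {x : Completion R G} (hx : IsGrouplike x) {l : ℕ}
    (f : coeffs k G l) :
    grouplikeHom hx (toCoeffAlgebra f) = truncPairing R f (Completion.proj l x) :=
  coeffEval_toCoeffAlgebra x f

theorem aeval_toCoeffAlgebra_eq_zero {l : ℕ} {σ : Type*} (c : σ → coeffs k G l)
    (q : MvPolynomial σ k) (hq : ∀ g, MvPolynomial.aeval (fun s => (c s).1 g) q = 0) :
    MvPolynomial.aeval (fun s => toCoeffAlgebra (c s)) q = 0 := by
  refine Subtype.ext (funext fun g => ?_)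
  have := MvPolynomial.comp_aeval_apply (fun s => toCoeffAlgebra (c s))
    ((Pi.evalAlgHom k (fun _ : G => k) g).comp (coeffAlgebra k G).val) q
  exact this.trans (hq g)

/-- A polynomial relation over `k` between coefficient functions persists at grouplike elements. -/
theorem IsGrouplike.aeval_eq_zero {x : Completion R G} (hx : IsGrouplike x) {l : ℕ} {σ : Type*}
    (c : σ → coeffs k G l) (q : MvPolynomial σ k)
    (hq : ∀ g, MvPolynomial.aeval (fun s => (c s).1 g) q = 0) :
    MvPolynomial.aeval (fun s => truncPairing R (c s) (Completion.proj l x)) q = 0 := by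
  -- The relation already holds in the algebra of functions on $G$, and $x$ is an algebra
  -- homomorphism from it to $R$.
  simp only [← grouplikeHom_toCoeffAlgebra hx]
  rw [← MvPolynomial.comp_aeval_apply]
  rw [aeval_toCoeffAlgebra_eq_zero c q hq, map_zero]

theorem IsGrouplike.isClosurePoint {x : Completion R G} (hx : IsGrouplike x) (l : ℕ) :
    IsClosurePoint k (Completion.proj l x) := fun q hq =>
  hx.aeval_eq_zero id q hq

theorem IsClosurePoint.factor {m n : ℕ} (h : m ≤ n) {x : Trunc R G n} (hx : IsClosurePoint k x) :
    IsClosurePoint k (Trunc.factor h x) := fun q hq => by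
  have := hx (MvPolynomial.rename (fun f => ⟨f.1, coeffs_mono h f.2⟩) q) fun g => by
    rw [MvPolynomial.aeval_rename]
    exact hq g
  rw [MvPolynomial.aeval_rename] at this
  simpa only [truncPairing_factor, Function.comp_def] using this

theorem IsClosurePoint.truncPairing_one_eq_one {l : ℕ} (hl : 1 ≤ l) {x : Trunc R G l}
    (hx : IsClosurePoint k x) :
    truncPairing R (⟨1, one_mem_coeffs hl⟩ : coeffs k G l) x = 1 := by
  have := hx (MvPolynomial.X ⟨1, one_mem_coeffs hl⟩ - 1) fun g => by simp
  simpa [sub_eq_zero] using this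

theorem tensorPairing_ext {l : ℕ} [FiniteDimensional k (Trunc k G l)]
    {x y : Trunc R G l ⊗[R] Trunc R G l}
    (h : ∀ f f' : coeffs k G l, tensorPairing R f f' x = tensorPairing R f f' y) : x = y := by
  let b := truncBasis k G R l
  refine (b.tensorProduct b).repr.injective (Finsupp.ext fun p => ?_)
  have key : (b.tensorProduct b).coord p =
      tensorPairing R (coordCoeff k G l p.1) (coordCoeff k G l p.2) :=
    TensorProduct.ext' fun x y => by
      rw [tensorPairing_tmul, ← truncBasis_repr, ← truncBasis_repr]
      rw [Module.Basis.coord_apply, Module.Basis.tensorProduct_repr_tmul_apply, smul_eq_mul,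
        mul_comm]
  have := h (coordCoeff k G l p.1) (coordCoeff k G l p.2)
  rw [← key] at this
  exact this

/-- An element of `R[G]^` is grouplike if its components lie in the closure of `G`. -/
theorem isGrouplike_of_isClosurePoint [∀ l, FiniteDimensional k (Trunc k G l)]
    {x : Completion R G} (hx : ∀ l, IsClosurePoint k (Completion.proj l x)) : IsGrouplike x := by
  refine ⟨fun l => tensorPairing_ext (k := k) fun f f' => ?_, ?_⟩
  · rw [comul, AlgHom.comp_apply, ← truncPairing_mul_eq, tensorPairing_tmul]
    have hl : l ≤ 2 * l := by omega
    -- The relation $(ff')(g)=f(g)f'(g)$ on $G$, read at level $2l$, where the product lives.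
    have := hx (2 * l) (MvPolynomial.X ⟨f.1 * f'.1, mul_mem_coeffs f.2 f'.2⟩ -
      MvPolynomial.X ⟨f.1, coeffs_mono hl f.2⟩ * MvPolynomial.X ⟨f'.1, coeffs_mono hl f'.2⟩)
      fun g => by simp
    rw [map_sub, map_mul, MvPolynomial.aeval_X, MvPolynomial.aeval_X, MvPolynomial.aeval_X,
      truncPairing_proj_of_le x hl f, truncPairing_proj_of_le x hl f'] at this
    exact sub_eq_zero.1 this
  · exact (truncPairing_one (k := k) R _).symm.trans ((hx 1).truncPairing_one_eq_one le_rfl)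

/-- A point of the closure of `G` differs from `1` by an element of the augmentation ideal. -/
theorem IsClosurePoint.exists_mk_eq_sub_one {l : ℕ} {x : Trunc R G l} (hx : IsClosurePoint k x) :
    ∃ a ∈ augIdeal R G, Trunc.mk l a = x - 1 := by
  obtain ⟨b, rfl⟩ := Trunc.mk_surjective l x
  -- At level $0$ the truncation is the zero ring and the constant function $1$ is not a coefficient
  -- function.
  rcases Nat.eq_zero_or_pos l with rfl | hl
  · refine ⟨0, zero_mem _, ?_⟩
    rw [← map_one (Trunc.mk 0), ← map_sub, map_zero, eq_comm, Trunc.mk_eq_zero_iff]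
    simp [Submodule.pow_zero]
  · refine ⟨b - 1, ?_, by rw [map_sub, map_one]⟩
    have h := hx.truncPairing_one_eq_one hl
    rw [truncPairing, Trunc.liftLinear_mk, pairing_one] at h
    rw [augIdeal, RingHom.mem_ker, map_sub, map_one]
    exact sub_eq_zero.2 h

end CoefficientAlgebra

/-! ### The closures as unipotent groups. -/

section ClosureFunctor

variable (k : Type u) [Field k] (G : Type u) [Group G] (l : ℕ)
  [FiniteDimensional k (Trunc k G l)]

/-- The Zariski closure of `G` in the group of units of `k[G] / J ^ l`, as a group functor. -/
def closureFunctor : GroupFunctor k where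
  obj R := GrpCat.of (closurePoints k G R l)
  map f := GrpCat.ofHom (closureMap f.hom)
  map_id R := by
    refine congrArg GrpCat.ofHom (MonoidHom.ext fun x => Subtype.ext (Units.ext ?_))
    change Trunc.map G (RingHom.id R) l x.1.1 = x.1.1
    obtain ⟨a, ha⟩ := Trunc.mk_surjective l x.1.1
    rw [← ha, Trunc.map_mk]
    simp
  map_comp {R S T} f g := by
    refine congrArg GrpCat.ofHom (MonoidHom.ext fun x => Subtype.ext (Units.ext ?_))
    change Trunc.map G (g.hom.toRingHom.comp f.hom.toRingHom) l x.1.1 =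
      Trunc.map G g.hom.toRingHom l (Trunc.map G f.hom.toRingHom l x.1.1)
    obtain ⟨a, ha⟩ := Trunc.mk_surjective l x.1.1
    rw [← ha, Trunc.map_mk, Trunc.map_mk, Trunc.map_mk, MonoidAlgebra.mapRingHom_comp]
    rfl

variable {k G l} in
theorem leftMulMatrix_map {R S : Type u} [CommRing R] [CommRing S] [Algebra k R] [Algebra k S]
    (φ : R →ₐ[k] S) (x : Trunc R G l) :
    Algebra.leftMulMatrix (truncBasis k G S l) (Trunc.map G φ.toRingHom l x) =
      (Algebra.leftMulMatrix (truncBasis k G R l) x).map φ := by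
  have hb : ∀ j, truncBasis k G S l j = Trunc.map G φ.toRingHom l (truncBasis k G R l j) :=
    fun j => by
      rw [truncBasis_apply, truncBasis_apply, truncVec, truncVec]
      obtain ⟨a, ha⟩ := Trunc.mk_surjective l (Module.finBasis k (Trunc k G l) j)
      rw [← ha, Trunc.map_mk, Trunc.map_mk, Trunc.map_mk, ← RingHom.comp_apply,
        ← MonoidAlgebra.mapRingHom_comp]
      congr 3
      exact φ.comp_algebraMap.symm
  ext i j
  rw [Matrix.map_apply, Algebra.leftMulMatrix_eq_repr_mul, Algebra.leftMulMatrix_eq_repr_mul,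
    truncBasis_repr, truncBasis_repr, hb, ← map_mul, truncPairing_map]

/-- The regular representation of the closure of `G` on `k[G] / J ^ l`. -/
def closureRep : closureFunctor k G l ⟶ generalLinear k (Module.finrank k (Trunc k G l)) where
  app R := GrpCat.ofHom
    ((Units.map (Algebra.leftMulMatrix (truncBasis k G R l) : Trunc R G l →* _)).comp
      (closurePoints k G R l).subtype)
  naturality R S f := by
    refine ConcreteCategory.hom_ext _ _ fun x => ?_
    exact Units.ext (leftMulMatrix_map f.hom x.1.1)

theorem repMatrix_closureRep {R : CommAlgCat.{u} k} (x : (closureFunctor k G l).obj R) :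
    repMatrix (closureRep k G l) x = Algebra.leftMulMatrix (truncBasis k G R l)
      (show closurePoints k G R l from x).1.1 := rfl

variable {k G l}

/-- The entries of the regular representation of `G` on `k[G] / J ^ l`. -/
def entryCoeff (p : Fin (Module.finrank k (Trunc k G l)) × Fin (Module.finrank k (Trunc k G l))) :
    coeffs k G l :=
  mulRightCoeff (coordCoeff k G l p.1) (Module.finBasis k (Trunc k G l) p.2)

theorem leftMulMatrix_apply_eq {R : Type u} [CommRing R] [Algebra k R] (x : Trunc R G l) (p) :
    Algebra.leftMulMatrix (truncBasis k G R l) x p.1 p.2 = truncPairing R (entryCoeff p) x := by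
  rw [Algebra.leftMulMatrix_eq_repr_mul, truncBasis_repr, truncBasis_apply, entryCoeff,
    truncPairing_mulRightCoeff]
  rfl

/-- The linear form in the entries of the regular representation that gives `f`. -/
def entryForm (f : coeffs k G l) : MvPolynomial
    (Fin (Module.finrank k (Trunc k G l)) × Fin (Module.finrank k (Trunc k G l))) k :=
  ∑ i, ∑ j, MvPolynomial.X (i, j) * MvPolynomial.C ((coordCoeff k G l j).1 1 *
    truncPairing k f (Module.finBasis k (Trunc k G l) i))

theorem aeval_entryForm {R : Type u} [CommRing R] [Algebra k R] (f : coeffs k G l)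
    (M : Matrix (Fin (Module.finrank k (Trunc k G l))) (Fin (Module.finrank k (Trunc k G l))) R) :
    MvPolynomial.aeval (fun p => M p.1 p.2) (entryForm f) = truncPairing R f
      (∑ i, (∑ j, M i j * algebraMap k R ((coordCoeff k G l j).1 1)) • truncBasis k G R l i) := by
  simp only [entryForm, map_sum, map_mul, MvPolynomial.aeval_X, MvPolynomial.aeval_C, map_smul,
    smul_eq_mul, Finset.sum_mul, truncBasis_apply, truncVec, truncPairing_algebraMap, mul_assoc]

/-- This is $x\cdot 1=x$ in coordinates: the scalars `(coordCoeff k G l j).1 1` are the coordinates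
of $1$. -/
theorem sum_leftMulMatrix_eq {R : Type u} [CommRing R] [Algebra k R] (x : Trunc R G l) :
    (∑ i, (∑ j, Algebra.leftMulMatrix (truncBasis k G R l) x i j *
      algebraMap k R ((coordCoeff k G l j).1 1)) • truncBasis k G R l i) = x := by
  conv_rhs => rw [← (truncBasis k G R l).sum_repr x]
  refine Finset.sum_congr rfl fun i _ => ?_
  congr 1
  rw [truncBasis_repr]
  conv_rhs => rw [← mul_one x, truncPairing_mul]
  refine Finset.sum_congr rfl fun j _ => ?_
  rw [leftMulMatrix_apply_eq x (i, j), mul_comm, ← truncPairing_of R, map_one, map_one (Trunc.mk l)]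
  rfl

/-- The equations are all polynomials in the entries that vanish on $G$. A matrix $M$ satisfying
them must be multiplication by $x=M\cdot 1$: the coordinates of $x$ are linear in $M$, so both that
$x$ is a closure point and that $M$ is its matrix are among the relations holding on $G$. -/
theorem isClosedEmbedding_closureRep : IsClosedEmbedding (closureRep k G l) := by
  refine ⟨{q | ∀ g : G, MvPolynomial.aeval (fun p => (entryCoeff (l := l) p).1 g) q = 0},
    fun R => ⟨fun x y h => ?_, fun M => ⟨?_, ?_⟩⟩⟩
  · exact Subtype.ext (Units.ext (Algebra.leftMulMatrix_injective (truncBasis k G R l) h))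
  · rintro ⟨x, rfl⟩
    refine ⟨Units.isUnit _, fun q hq => ?_⟩
    have := x.2 (MvPolynomial.rename entryCoeff q) fun g => by
      rw [MvPolynomial.aeval_rename]
      exact hq g
    rw [MvPolynomial.aeval_rename] at this
    rw [repMatrix_closureRep]
    simp only [leftMulMatrix_apply_eq]
    exact this
  · rintro ⟨-, hM⟩
    let x : Trunc R G l := ∑ i, (∑ j, M i j * algebraMap k R ((coordCoeff k G l j).1 1)) •
      truncBasis k G R l i
    have hform : ∀ (f : coeffs k G l) (g : G),
        MvPolynomial.aeval (fun p => (entryCoeff (l := l) p).1 g) (entryForm f) = f.1 g :=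
      fun f g => by
        have h := aeval_entryForm f (Algebra.leftMulMatrix (truncBasis k G k l)
          (Trunc.mk l (MonoidAlgebra.of k G g)))
        rw [sum_leftMulMatrix_eq] at h
        simp only [leftMulMatrix_apply_eq, truncPairing_of] at h
        exact h
    have hx : IsClosurePoint k x := fun q hq => by
      have := hM (MvPolynomial.aeval entryForm q) fun g => by
        rw [MvPolynomial.comp_aeval_apply]
        simp only [hform]
        exact hq g
      rw [MvPolynomial.comp_aeval_apply] at this
      simpa only [aeval_entryForm] using this
    refine ⟨hx.toUnit, ?_⟩
    ext i j
    refine (leftMulMatrix_apply_eq x (i, j)).trans ?_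
    have := hM (MvPolynomial.X (i, j) - entryForm (entryCoeff (i, j))) fun g => by
      rw [map_sub, hform, MvPolynomial.aeval_X, sub_self]
    rw [map_sub, aeval_entryForm, MvPolynomial.aeval_X] at this
    exact (sub_eq_zero.1 this).symm

/-- The filtration is by the images of $J^i$. A closure point minus $1$ comes from $J_R$, an
$R$-combination of elements of $J_k$, and $J_kJ_k^i\subseteq J_k^{i+1}$. -/
theorem actsUnipotently_closureRep : ActsUnipotently (closureRep k G l) := by
  let b := Module.finBasis k (Trunc k G l)
  let V : ℕ → Submodule k (Fin (Module.finrank k (Trunc k G l)) → k) := fun i =>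
    ((augPow k G i).map (Trunc.mk l).toLinearMap).map b.equivFun.toLinearMap
  refine ⟨l, V, ?_, ?_, ?_, ?_⟩
  · refine eq_top_iff.2 fun v _ => ?_
    obtain ⟨a, ha⟩ := Trunc.mk_surjective l (b.equivFun.symm v)
    refine ⟨_, ⟨a, ?_, rfl⟩, ?_⟩
    · change a ∈ augIdeal k G ^ 0
      simp [Submodule.pow_zero]
    · change b.equivFun (Trunc.mk l a) = v
      rw [ha, LinearEquiv.apply_symm_apply]
  · refine eq_bot_iff.2 ?_
    rintro _ ⟨_, ⟨a, ha, rfl⟩, rfl⟩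
    change b.equivFun (Trunc.mk l a) = 0
    rw [Trunc.mk_eq_zero_iff.2 ha, map_zero]
  · exact fun i j hij => Submodule.map_mono (Submodule.map_mono fun a ha =>
      Ideal.pow_le_pow_right hij ha)
  · rintro i R x _ ⟨_, ⟨a, ha, rfl⟩, rfl⟩
    have hrepr : ∀ y : Trunc k G l, algebraMap k R ∘ b.equivFun y =
        (truncBasis k G R l).equivFun (Trunc.map G (algebraMap k R) l y) := fun y => by
      funext j
      rw [(truncBasis k G R l).equivFun_apply, truncBasis_repr, truncPairing_algebraMap,
        coordCoeff, truncPairing_coeffOfDual]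
      rfl
    obtain ⟨c, hc, hcx⟩ :=
      (show IsClosurePoint k (x.1.1 : Trunc R G l) from x.2).exists_mk_eq_sub_one
    have hmul : Trunc.mk l c * Trunc.map G (algebraMap k R) l (Trunc.mk l a) ∈
        Submodule.span R (Trunc.map G (algebraMap k R) l ''
          ((augPow k G (i + 1)).map (Trunc.mk l).toLinearMap)) := by
      have hc' := augIdeal_le_span (k := k) R hc
      clear hcx hc
      induction hc' using Submodule.span_induction with
      | zero => rw [map_zero, zero_mul]; exact zero_mem _
      | add c d _ _ hc hd => rw [map_add, add_mul]; exact add_mem hc hd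
      | smul r c _ hc => rw [map_smul, smul_mul_assoc]; exact Submodule.smul_mem _ _ hc
      | mem c hc =>
        obtain ⟨d, hd, rfl⟩ := hc
        refine Submodule.subset_span ⟨Trunc.mk l (d * a), ⟨d * a, ?_, rfl⟩, ?_⟩
        · change d * a ∈ augIdeal k G ^ (i + 1)
          rw [Ideal.IsTwoSided.pow_succ]
          exact Ideal.mul_mem_mul hd ha
        · rw [map_mul, map_mul, ← Trunc.map_mk]
    have hmem := Submodule.mem_map_of_mem (f := (truncBasis k G R l).equivFun.toLinearMap) hmul
    rw [Submodule.map_span, ← Set.image_comp] at hmem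
    convert hmem using 1
    · congr 1
      ext w
      constructor
      · rintro ⟨_, ⟨y, hy, rfl⟩, rfl⟩
        exact ⟨y, hy, (hrepr y).symm⟩
      · rintro ⟨y, hy, rfl⟩
        exact ⟨_, ⟨y, hy, rfl⟩, hrepr y⟩
    · change Matrix.mulVec _ (algebraMap k R ∘ b.equivFun (Trunc.mk l a)) - _ = _
      rw [hrepr, repMatrix_closureRep, hcx]
      have := Algebra.leftMulMatrix_mulVec_repr (truncBasis k G R l) x.1.1
        (Trunc.map G (algebraMap k R) l (Trunc.mk l a))
      refine (congrArg (· - _) this).trans ?_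
      rw [LinearEquiv.coe_coe, sub_mul, one_mul, map_sub]
      exact congrArg (_ - ·) (hrepr (Trunc.mk l a))

theorem isUnipotent_closureFunctor : IsUnipotent (closureFunctor k G l) :=
  ⟨_, closureRep k G l, isClosedEmbedding_closureRep, actsUnipotently_closureRep⟩

/-! ### The grouplike functor as the limit of the closures. -/

section Limit

variable (k G) [∀ l, FiniteDimensional k (Trunc k G l)]

/-- The projection between the points of the closures of `G` in two truncations of `k[G]`. -/
def closureFactorHom (R : Type u) [CommRing R] [Algebra k R] {m n : ℕ} (h : m ≤ n) :
    closurePoints k G R n →* closurePoints k G R m where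
  toFun x := IsClosurePoint.toUnit (x := Trunc.factor h (x.1 : Trunc R G n))
    (IsClosurePoint.factor h (show IsClosurePoint k (x.1 : Trunc R G n) from x.2))
  map_one' := Subtype.ext (Units.ext (map_one (Trunc.factor h)))
  map_mul' x y := Subtype.ext (Units.ext (map_mul (Trunc.factor h) x.1.1 y.1.1))

/-- The projection between the closures of `G` in two truncations of `k[G]`. -/
def closureFactor {m n : ℕ} (h : m ≤ n) : closureFunctor k G n ⟶ closureFunctor k G m where
  app R := GrpCat.ofHom (closureFactorHom k G R h)
  naturality R S f := by
    refine ConcreteCategory.hom_ext _ _ fun x => Subtype.ext (Units.ext ?_)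
    change Trunc.factor h (Trunc.map G f.hom.toRingHom n x.1.1) =
      Trunc.map G f.hom.toRingHom m (Trunc.factor h x.1.1)
    obtain ⟨a, ha⟩ := Trunc.mk_surjective n x.1.1
    rw [← ha, Trunc.map_mk, Trunc.factor_mk, Trunc.factor_mk, Trunc.map_mk]

/-- The inverse system of the closures of `G` in the truncations of `k[G]`. -/
def closureDiagram : (ULift.{u} ℕ)ᵒᵖ ⥤ GroupFunctor k where
  obj j := closureFunctor k G j.unop.down
  map {i j} h := closureFactor k G (show j.unop ≤ i.unop from leOfHom h.unop)
  map_id j := by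
    ext R x
    refine Subtype.ext (Units.ext ?_)
    obtain ⟨a, ha⟩ := Trunc.mk_surjective _ x.1.1
    change Trunc.factor _ x.1.1 = x.1.1
    rw [← ha, Trunc.factor_mk]
  map_comp h h' := by
    ext R x
    refine Subtype.ext (Units.ext ?_)
    obtain ⟨a, ha⟩ := Trunc.mk_surjective _ x.1.1
    change Trunc.factor _ x.1.1 = Trunc.factor _ (Trunc.factor _ x.1.1)
    rw [← ha, Trunc.factor_mk, Trunc.factor_mk, Trunc.factor_mk]

/-- The projection from the grouplike elements to the points of the closure of `G` in
`k[G] / J ^ l`. -/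
def grouplikeProjHom (R : Type u) [CommRing R] [Algebra k R] (l : ℕ) :
    grouplikes R G →* closurePoints k G R l where
  toFun x := IsClosurePoint.toUnit (x := Completion.proj l (x.1 : Completion R G))
    (IsGrouplike.isClosurePoint (show IsGrouplike (x.1 : Completion R G) from x.2) l)
  map_one' := Subtype.ext (Units.ext (map_one (Completion.proj l)))
  map_mul' x y := Subtype.ext (Units.ext (map_mul (Completion.proj l) x.1.1 y.1.1))

/-- The projection from the grouplike elements to the closure of `G` in `k[G] / J ^ l`. -/
def grouplikeProj (l : ℕ) : grouplikeFunctor k G ⟶ closureFunctor k G l where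
  app R := GrpCat.ofHom (grouplikeProjHom k G R l)
  naturality R S f := by
    refine ConcreteCategory.hom_ext _ _ fun x => Subtype.ext (Units.ext ?_)
    change Completion.proj l (Completion.map G f.hom.toRingHom x.1.1) =
      Trunc.map G f.hom.toRingHom l (Completion.proj l x.1.1)
    rfl

/-- The cone of the projections of the grouplike elements. -/
def grouplikeCone : (Functor.const (ULift.{u} ℕ)ᵒᵖ).obj (grouplikeFunctor k G) ⟶
    closureDiagram k G where
  app j := grouplikeProj k G j.unop.down
  naturality i j h := by
    ext R x
    exact Subtype.ext (Units.ext (Completion.factor_proj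
      (show j.unop ≤ i.unop from leOfHom h.unop) x.1.1).symm)

/-- The limit can be tested on underlying sets of $R$-points. A compatible family of closure points
is an element of $R[G]^\wedge$, grouplike by `isGrouplike_of_isClosurePoint`. -/
theorem isLimit_grouplikeCone :
    Nonempty (Limits.IsLimit (Limits.Cone.mk (grouplikeFunctor k G) (grouplikeCone k G))) := by
  refine ⟨Limits.evaluationJointlyReflectsLimits _ fun R =>
    Limits.isLimitOfReflects (forget GrpCat) (Nonempty.some ?_)⟩
  rw [Limits.Types.isLimit_iff]
  intro s hs
  let y : ∀ l : ℕ, closurePoints k G R l := fun l => s (Opposite.op ⟨l⟩)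
  have hy : ∀ (m n : ℕ) (h : m ≤ n), Trunc.factor h (y n).1.1 = (y m).1.1 := fun m n h => by
    have := hs (j := Opposite.op ⟨n⟩) (j' := Opposite.op ⟨m⟩)
      (homOfLE (show (⟨m⟩ : ULift ℕ) ≤ ⟨n⟩ from h)).op
    exact congrArg (fun z : closurePoints k G R m => z.1.1) this
  let x : Completion R G := ⟨fun l => (y l).1.1, hy⟩
  have hx : IsGrouplike x := isGrouplike_of_isClosurePoint (k := k) fun l => (y l).2
  refine ⟨(⟨hx.isUnit.unit, hx⟩ : grouplikes R G), fun j => ?_, fun z hz => ?_⟩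
  · exact Subtype.ext (Units.ext rfl)
  · refine Subtype.ext (Units.ext (Completion.ext fun l => ?_))
    exact congrArg (fun z : closurePoints k G R l => z.1.1) (hz (Opposite.op ⟨l⟩))

theorem isProunipotent_grouplikeFunctor : IsProunipotent (grouplikeFunctor k G) :=
  ⟨(ULift.{u} ℕ)ᵒᵖ, inferInstance, inferInstance, closureDiagram k G, grouplikeCone k G,
    fun _ => isUnipotent_closureFunctor, isLimit_grouplikeCone k G⟩

end Limit

end ClosureFunctor

/-! ### The universal grouplike element. -/

section UniversalPoint

variable (k : Type u) [Field k] (G : Type u) [Group G] [∀ l, FiniteDimensional k (Trunc k G l)]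

/-- The component in the truncation of level `l` of the universal grouplike element. -/
def universalTrunc (l : ℕ) : Trunc (coeffAlgebra k G) G l :=
  ∑ i, toCoeffAlgebra (coordCoeff k G l i) • truncBasis k G (coeffAlgebra k G) l i

variable {k G} in
-- Both sides are functions on $G$; at $g$ the identity is the basis expansion of $g$ paired with
-- $f$.
theorem truncPairing_universalTrunc {l : ℕ} (f : coeffs k G l) :
    truncPairing (coeffAlgebra k G) f (universalTrunc k G l) = toCoeffAlgebra f := by
  refine Subtype.ext (funext fun g => ?_)
  have h := congrArg (truncPairing k f)
    (sum_truncPairing_smul (k := k) k l (Trunc.mk l (MonoidAlgebra.of k G g)))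
  simp only [map_sum, map_smul, truncPairing_of, smul_eq_mul, truncVec,
    truncPairing_algebraMap] at h
  simp only [Algebra.algebraMap_self, RingHom.id_apply] at h
  refine Eq.trans ?_ h
  simp only [universalTrunc, truncBasis_apply, truncVec, map_sum, map_smul,
    truncPairing_algebraMap, smul_eq_mul]
  rw [AddSubmonoidClass.coe_finsetSum, Finset.sum_apply]
  rfl

/-- The universal grouplike element, over the coefficient algebra. -/
def universalCompletion : Completion (coeffAlgebra k G) G :=
  ⟨universalTrunc k G, fun m n h => truncPairing_ext (k := k) fun f => by
    rw [truncPairing_factor, truncPairing_universalTrunc, truncPairing_universalTrunc]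
    rfl⟩

theorem isGrouplike_universalCompletion : IsGrouplike (universalCompletion k G) :=
  isGrouplike_of_isClosurePoint (k := k) fun l q hq => by
    have : ∀ f : coeffs k G l, truncPairing (coeffAlgebra k G) f
        (Completion.proj l (universalCompletion k G)) = toCoeffAlgebra f :=
      truncPairing_universalTrunc
    simp only [this]
    exact aeval_toCoeffAlgebra_eq_zero id q hq

/-- The universal grouplike element, as a point of the group functor. -/
def universalPoint : (grouplikeFunctor k G).obj (CommAlgCat.of k (coeffAlgebra k G)) :=
  (⟨(isGrouplike_universalCompletion k G).isUnit.unit, isGrouplike_universalCompletion k G⟩ :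
    grouplikes (coeffAlgebra k G) G)

variable {k G}

/-- Every grouplike element is the image of the universal one. -/
theorem map_universalPoint {R : CommAlgCat.{u} k} (x : (grouplikeFunctor k G).obj R) :
    (grouplikeFunctor k G).map (CommAlgCat.ofHom (grouplikeHom (k := k)
      (show IsGrouplike ((show grouplikes R G from x).1 : Completion R G) from x.2)))
      (universalPoint k G) = x := by
  refine Subtype.ext (Units.ext (Completion.ext fun l => truncPairing_ext (k := k) fun f => ?_))
  change truncPairing R f (Trunc.map G (AlgHom.toRingHom _) l (universalTrunc k G l)) = _
  rw [truncPairing_map, truncPairing_universalTrunc]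
  exact grouplikeHom_toCoeffAlgebra
    (show IsGrouplike ((show grouplikes R G from x).1 : Completion R G) from x.2) f

variable (k G) in
/-- Evaluation of functions in the coefficient algebra at an element of `G`. -/
def evalAt (g : G) : coeffAlgebra k G →ₐ[k] k :=
  (Pi.evalAlgHom k (fun _ : G => k) g).comp (coeffAlgebra k G).val

theorem map_evalAt_universalPoint (g : G) :
    (grouplikeFunctor k G).map (CommAlgCat.ofHom (evalAt k G g)) (universalPoint k G) =
      toGrouplikes k G g := by
  refine Subtype.ext (Units.ext (Completion.ext fun l => truncPairing_ext (k := k) fun f => ?_))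
  change truncPairing k f (Trunc.map G (AlgHom.toRingHom _) l (universalTrunc k G l)) =
    truncPairing k f (Trunc.mk l (MonoidAlgebra.of k G g))
  rw [truncPairing_map, truncPairing_universalTrunc, truncPairing_of]
  rfl

end UniversalPoint

/-! ### Uniqueness of homomorphisms to unipotent groups. -/

section Representation

variable {k : Type u} [Field k] {E : GroupFunctor k} {n : ℕ} (ρ : E ⟶ generalLinear k n)

theorem repMatrix_one (R : CommAlgCat.{u} k) : repMatrix ρ (1 : E.obj R) = 1 :=
  congrArg (fun M : Matrix.GeneralLinearGroup (Fin n) R => M.val) (map_one (ρ.app R).hom)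

theorem repMatrix_mul {R : CommAlgCat.{u} k} (x y : E.obj R) :
    repMatrix ρ (x * y) = repMatrix ρ x * repMatrix ρ y :=
  congrArg (fun M : Matrix.GeneralLinearGroup (Fin n) R => M.val) (map_mul (ρ.app R).hom x y)

theorem repMatrix_map {R S : CommAlgCat.{u} k} (f : R ⟶ S) (x : E.obj R) :
    repMatrix ρ (E.map f x) = (repMatrix ρ x).map f.hom :=
  congrArg (fun M : Matrix.GeneralLinearGroup (Fin n) S => M.val)
    (ConcreteCategory.congr_hom (ρ.naturality f) x)

variable {ρ} in
/-- Homomorphisms from the group functor of grouplike elements to a linear group are determined by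
their values on `G`. -/
theorem hom_ext_of_isClosedEmbedding {G : Type u} [Group G]
    [∀ l, FiniteDimensional k (Trunc k G l)] (hρ : IsClosedEmbedding ρ)
    {Φ Ψ : grouplikeFunctor k G ⟶ E}
    (h : ∀ g : G, Φ.app (CommAlgCat.of k k) (toGrouplikes k G g) =
      Ψ.app (CommAlgCat.of k k) (toGrouplikes k G g)) : Φ = Ψ := by
  obtain ⟨S, hS⟩ := hρ
  have hnat : ∀ (Φ : grouplikeFunctor k G ⟶ E) {R R' : CommAlgCat.{u} k} (f : R ⟶ R')
      (x : (grouplikeFunctor k G).obj R),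
      Φ.app R' ((grouplikeFunctor k G).map f x) = E.map f (Φ.app R x) := fun Φ _ _ f x =>
    ConcreteCategory.congr_hom (Φ.naturality f) x
  have hu : Φ.app _ (universalPoint k G) = Ψ.app _ (universalPoint k G) := by
    refine (hS _).1 ?_
    -- Entries over the coefficient algebra are functions on $G$, and evaluation at $g$ specialises
    -- the universal point to $g$.
    ext i j g
    have hg := h g
    rw [← map_evalAt_universalPoint, hnat, hnat] at hg
    have := congrArg (fun y => repMatrix ρ y i j) hg
    simp only [repMatrix_map] at this
    exact this
  ext R x
  change Φ.app R x = Ψ.app R x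
  rw [← map_universalPoint x, hnat, hnat, hu]

/-! ### Existence of lifts, and passage to prounipotent groups. -/

section Existence

variable {G : Type u} [Group G] (φ : G →* E.obj (CommAlgCat.of k k))

/-- The matrix representation of `G` over `R` given by a homomorphism `G → E(k)`. -/
def matrixRep (R : Type u) [CommRing R] [Algebra k R] : G →* Matrix (Fin n) (Fin n) R where
  toFun g := (show Matrix (Fin n) (Fin n) k from repMatrix ρ (φ g)).map (algebraMap k R)
  map_one' := by
    rw [map_one, repMatrix_one]
    exact Matrix.map_one _ (map_zero _) (map_one _)
  map_mul' g h := by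
    rw [map_mul, repMatrix_mul]
    exact Matrix.map_mul

/-- The matrix representation of `R[G]` given by a homomorphism `G → E(k)`. -/
def matrixAlgRep (R : Type u) [CommRing R] [Algebra k R] :
    MonoidAlgebra R G →ₐ[R] Matrix (Fin n) (Fin n) R :=
  MonoidAlgebra.lift R (Matrix (Fin n) (Fin n) R) G (matrixRep ρ φ R)

/-- A matrix coefficient of a homomorphism `G → E(k)`. -/
def matrixCoeff (i j : Fin n) (g : G) : k := repMatrix ρ (φ g) i j

theorem matrixAlgRep_apply (R : Type u) [CommRing R] [Algebra k R] (a : MonoidAlgebra R G)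
    (i j : Fin n) : matrixAlgRep ρ φ R a i j = pairing R (matrixCoeff ρ φ i j) a := by
  induction a using MonoidAlgebra.induction_linear with
  | zero => simp
  | add a b ha hb => simp only [map_add, Matrix.add_apply, ha, hb]
  | single g r =>
    rw [pairing_single, matrixAlgRep, MonoidAlgebra.lift_single, Matrix.smul_apply, smul_eq_mul]
    rfl

variable {ρ} in
/-- The matrix coefficients of a unipotent representation extend to some truncation of `k[G]`. -/
theorem ActsUnipotently.exists_matrixCoeff_mem (hρ : ActsUnipotently ρ) :
    ∃ m, ∀ i j, matrixCoeff ρ φ i j ∈ coeffs k G m := by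
  obtain ⟨m, V, hV0, hVm, hanti, hV⟩ := hρ
  -- As $J$ is spanned by the $g-1$, this reduces to unipotency of the action on $k$-points.
  have hJ : ∀ a ∈ augIdeal k G, ∀ i, ∀ v ∈ V i, (matrixAlgRep ρ φ k a).mulVec v ∈ V (i + 1) := by
    intro a ha i v hv
    have hspan := sub_counit_mem_span a
    rw [show Bialgebra.counitAlgHom k (MonoidAlgebra k G) a = 0 from ha, map_zero,
      sub_zero] at hspan
    clear ha
    induction hspan using Submodule.span_induction with
    | zero => simp
    | add a b _ _ ha hb => rw [map_add, Matrix.add_mulVec]; exact add_mem ha hb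
    | smul r a _ ha =>
      rw [map_smul, Matrix.smul_mulVec]
      exact Submodule.smul_mem _ _ ha
    | mem a ha =>
      obtain ⟨g, rfl⟩ := ha
      have h := hV i (CommAlgCat.of k k) (φ g) v hv
      have hset : (fun w : Fin n → k => algebraMap k (CommAlgCat.of k k) ∘ w) '' (V (i + 1)) =
          V (i + 1) := Set.image_id _
      rw [hset] at h
      have h' := (Submodule.span_eq (V (i + 1))).le h
      have hg : matrixAlgRep ρ φ k (MonoidAlgebra.of k G g) = repMatrix ρ (φ g) := by
        rw [matrixAlgRep, MonoidAlgebra.lift_of]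
        rfl
      rw [map_sub, map_one, Matrix.sub_mulVec, Matrix.one_mulVec, hg]
      exact h'
  have hpow : ∀ (l : ℕ), ∀ a ∈ augIdeal k G ^ l, ∀ i, ∀ v ∈ V i,
      (matrixAlgRep ρ φ k a).mulVec v ∈ V (i + l) := by
    intro l
    induction l with
    | zero =>
      intro a _ i v hv
      -- For $l=0$ only stability of $V_i$ is claimed: $a$ is a scalar plus an element of $J$.
      have ha : a - algebraMap k _ (Bialgebra.counitAlgHom k (MonoidAlgebra k G) a) ∈
          augIdeal k G := by
        rw [augIdeal, RingHom.mem_ker, map_sub]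
        exact sub_eq_zero.2 (AlgHom.commutes (Bialgebra.counitAlgHom k (MonoidAlgebra k G)) _).symm
      have h := add_mem (hanti (Nat.le_succ i) (hJ _ ha i v hv)) (Submodule.smul_mem (V i)
        (Bialgebra.counitAlgHom k (MonoidAlgebra k G) a) hv)
      rw [map_sub, AlgHom.commutes, Matrix.sub_mulVec, Algebra.algebraMap_eq_smul_one,
        Matrix.smul_mulVec, Matrix.one_mulVec, sub_add_cancel] at h
      exact h
    | succ l ih =>
      intro a ha i v hv
      rw [Submodule.pow_succ] at ha
      induction ha using Submodule.mul_induction_on' with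
      | add x _ y _ hx hy => rw [map_add, Matrix.add_mulVec]; exact add_mem hx hy
      | mem_mul_mem x hx y hy =>
        rw [map_mul, ← Matrix.mulVec_mulVec, ← add_assoc, add_right_comm]
        exact ih x hx (i + 1) _ (hJ y hy i v hv)
  refine ⟨m, fun i j a ha => ?_⟩
  rw [← matrixAlgRep_apply]
  -- An element of $J^m$ moves $V_0=k^n$ into $V_m=0$, so its matrix is zero.
  have h := hpow m a ha 0 (Pi.single j 1) (hV0 ▸ Submodule.mem_top)
  rw [zero_add, hVm, Submodule.mem_bot] at h
  have h' := congrFun h i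
  rwa [Matrix.mulVec_single_one] at h'

variable {m : ℕ} (hm : ∀ i j, matrixCoeff ρ φ i j ∈ coeffs k G m)

/-- The matrix representation of `R[G] / J ^ m` given by a homomorphism `G → E(k)`. -/
def truncRep (R : Type u) [CommRing R] [Algebra k R] : Trunc R G m →* Matrix (Fin n) (Fin n) R :=
  have key : ∀ a i j, truncPairing R (⟨_, hm i j⟩ : coeffs k G m) (Trunc.mk m a) =
      matrixAlgRep ρ φ R a i j := fun a i j => by
    rw [matrixAlgRep_apply, truncPairing, Trunc.liftLinear_mk]
  { toFun := fun x => Matrix.of fun i j => truncPairing R (⟨_, hm i j⟩ : coeffs k G m) x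
    map_one' := by
      ext i j
      rw [Matrix.of_apply, ← map_one (Trunc.mk m), key, map_one]
    map_mul' := fun x y => by
      obtain ⟨a, rfl⟩ := Trunc.mk_surjective m x
      obtain ⟨b, rfl⟩ := Trunc.mk_surjective m y
      simp only [← map_mul (Trunc.mk m), key]
      exact map_mul (matrixAlgRep ρ φ R) a b }

variable {ρ}

theorem exists_repMatrix_eq_truncRep (hρ : IsClosedEmbedding ρ) {R : CommAlgCat.{u} k}
    {x : Completion R G} (hx : IsGrouplike x) :
    ∃ y : E.obj R, repMatrix ρ y = truncRep ρ φ hm R (Completion.proj m x) := by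
  obtain ⟨S, hS⟩ := hρ
  refine ((hS R).2 _).2 ⟨(hx.isUnit.map (Completion.proj m)).map (truncRep ρ φ hm R),
    fun q hq => ?_⟩
  -- The equations of $E$ hold at each $\phi(g)$, so they are relations between coefficient
  -- functions on $G$ and persist at $x$.
  exact hx.aeval_eq_zero (fun p : Fin n × Fin n => (⟨_, hm p.1 p.2⟩ : coeffs k G m)) q fun g =>
    (((hS (CommAlgCat.of k k)).2 _).1 ⟨φ g, rfl⟩).2 q hq

/-- The image in `E(R)` of a grouplike element of `R[G]^`. -/
def liftPoint (hρ : IsClosedEmbedding ρ) {R : CommAlgCat.{u} k} (x : grouplikes R G) : E.obj R :=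
  (exists_repMatrix_eq_truncRep φ hm hρ (show IsGrouplike (x.1 : Completion R G) from x.2)).choose

theorem repMatrix_liftPoint (hρ : IsClosedEmbedding ρ) {R : CommAlgCat.{u} k}
    (x : grouplikes R G) : repMatrix ρ (liftPoint φ hm hρ x) =
      truncRep ρ φ hm R (Completion.proj m (x.1 : Completion R G)) :=
  (exists_repMatrix_eq_truncRep φ hm hρ
    (show IsGrouplike (x.1 : Completion R G) from x.2)).choose_spec

/-- The homomorphism from the group functor of grouplike elements to a unipotent group that extends
a homomorphism from `G`. -/
def liftUnipotent (hρ : IsClosedEmbedding ρ) : grouplikeFunctor k G ⟶ E where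
  app R := GrpCat.ofHom (MonoidHom.mk' (M := grouplikes R G) (G := E.obj R)
    (liftPoint φ hm hρ)
    (fun x y => by
      -- `liftPoint` is a choice, but points of $E$ are determined by their matrices, so
      -- multiplicativity is checked there.
      refine (hρ.choose_spec R).1 ?_
      rw [repMatrix_mul, repMatrix_liftPoint, repMatrix_liftPoint, repMatrix_liftPoint, ← map_mul,
        ← map_mul]
      rfl))
  naturality R S f := by
    refine ConcreteCategory.hom_ext _ _ fun x => (hρ.choose_spec S).1 ?_
    change repMatrix ρ (liftPoint φ hm hρ (grouplikesMap G f.hom.toRingHom x)) =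
      repMatrix ρ (E.map f (liftPoint φ hm hρ (show grouplikes R G from x)))
    rw [repMatrix_map, repMatrix_liftPoint, repMatrix_liftPoint]
    ext i j
    exact truncPairing_map f.hom (⟨_, hm i j⟩ : coeffs k G m) _

theorem liftUnipotent_toGrouplikes (hρ : IsClosedEmbedding ρ) (g : G) :
    (liftUnipotent φ hm hρ).app (CommAlgCat.of k k) (toGrouplikes k G g) = φ g := by
  refine (hρ.choose_spec _).1 ?_
  change repMatrix ρ (liftPoint φ hm hρ (R := CommAlgCat.of k k) (toGrouplikes k G g)) = _
  rw [repMatrix_liftPoint]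
  ext i j
  exact truncPairing_of k (⟨_, hm i j⟩ : coeffs k G m) g

theorem IsUnipotent.existsUnique_lift [∀ l, FiniteDimensional k (Trunc k G l)]
    (hE : IsUnipotent E) : ∃! Φ : grouplikeFunctor k G ⟶ E,
      ∀ g : G, Φ.app (CommAlgCat.of k k) (toGrouplikes k G g) = φ g := by
  obtain ⟨n, ρ, hρ, hact⟩ := hE
  obtain ⟨m, hm⟩ := hact.exists_matrixCoeff_mem φ
  exact ⟨liftUnipotent φ hm hρ, liftUnipotent_toGrouplikes φ hm hρ, fun Ψ hΨ =>
    hom_ext_of_isClosedEmbedding hρ fun g =>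
      (hΨ g).trans (liftUnipotent_toGrouplikes φ hm hρ g).symm⟩

/-- Uniqueness at each term makes the lifts compatible, so they assemble to a map into the limit. It
extends $\phi$ because taking $k$-points preserves the limit. -/
theorem IsProunipotent.existsUnique_lift [∀ l, FiniteDimensional k (Trunc k G l)]
    (hE : IsProunipotent E) : ∃! Φ : grouplikeFunctor k G ⟶ E,
      ∀ g : G, Φ.app (CommAlgCat.of k k) (toGrouplikes k G g) = φ g := by
  obtain ⟨J, _, _, D, π, hD, ⟨hlim⟩⟩ := hE
  let φ' : ∀ j, G →* (D.obj j).obj (CommAlgCat.of k k) := fun j =>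
    ((π.app j).app (CommAlgCat.of k k)).hom.comp φ
  choose Φ hΦ hΦu using fun j => (hD j).existsUnique_lift (φ' j)
  have hcompat : ∀ {i j : J} (f : i ⟶ j), Φ i ≫ D.map f = Φ j := fun {i j} f =>
    hΦu j _ fun g => by
      change ((D.map f).app _) ((Φ i).app _ _) = _
      rw [hΦ i g]
      change ((π.app i ≫ D.map f).app _) (φ g) = (π.app j).app _ (φ g)
      rw [← π.naturality f]
      rfl
  let s : Limits.Cone D := Limits.Cone.mk (grouplikeFunctor k G)
    { app := Φ
      naturality := fun i j f => by
        rw [hcompat f]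
        exact Category.id_comp _ }
  have hfac : ∀ j, hlim.lift s ≫ π.app j = Φ j := hlim.fac s
  have hlim' := Limits.isLimitOfPreserves
    ((evaluation (CommAlgCat.{u} k) GrpCat.{u}).obj (CommAlgCat.of k k)) hlim
  refine ⟨hlim.lift s, fun g => ?_, fun Ψ hΨ => hlim.hom_ext fun j => ?_⟩
  · refine Limits.Concrete.isLimit_ext _ hlim' _ _ fun j => ?_
    change (hlim.lift s ≫ π.app j).app _ _ = (π.app j).app _ (φ g)
    rw [hfac j]
    exact hΦ j g
  · refine Eq.trans ?_ (hfac j).symm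
    refine hΦu j _ fun g => ?_
    change (π.app j).app _ (Ψ.app _ _) = (π.app j).app _ (φ g)
    rw [hΨ g]

end Existence

end Representation

end

end UnipotentCompletion

theorem proposition2p6 (k : Type u) [Field k] (G : Type u) [Group G]
    (hH : FiniteDimensional k (groupHomology (Rep.trivial k G k) 1)) :
    UnipotentCompletion.IsUnipotentCompletion (UnipotentCompletion.grouplikeFunctor k G)
      (UnipotentCompletion.toGrouplikes k G) := by
  have := UnipotentCompletion.finiteDimensional_trunc hH
  exact ⟨UnipotentCompletion.isProunipotent_grouplikeFunctor k G,
    fun E hE φ => hE.existsUnique_lift φ⟩
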